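/- Let $g:[1,\infty)\to(0,\infty)$ be monotonic and thrice differentiable, and suppose that for some $\gamma\le 0$, as $x\to\infty$, $$g(x)=x^{\gamma+o(1)},\quad g'(x)=[\gamma+o(1)]\frac{g(x)}{x},\quad g''(x)=[\gamma(\gamma-1)+o(1)]\frac{g(x)}{x^2},\quad |g'''(x)|=o(x^{-2}),$$ and $g(x)\to 0$. Let $\alpha$ be a random angle such that ${\mathbf P}[|\alpha|<\bar\alpha]=1$ for some $\bar\alpha\in(0,\pi/2)$ and ${\mathbf P}[\alpha\ge x]={\mathbf P}[\alpha\le -x]$ for all $x\in{\mathbb R}$. For $A\ge 1$ let ${\mathcal D}=\{(x,y)\in{\mathbb R}^2: x>A,\ |y|<g(x)\}$. The collisions process $\xi=(\xi_n)_{n\ge 0}$ on $\partial{\mathcal D}\cup\{\underline{\infty}\}$, started at a fixed point $\xi_0\in\partial{\mathcal D}$ and driven by i.i.d. copies $\alpha_0,\alpha_1,\dots$ of $\alpha$, is defined as follows. The state $\underline{\infty}$ is absorbing. If $\xi_k\in\partial{\mathcal D}$, consider the ray from $\xi_k$ at angle $\alpha_k$ to the interior normal to $\partial{\mathcal D}$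 at $\xi_k$ (positive angles being to the right of the normal). If this ray does not meet $\partial{\mathcal D}\setminus\{\xi_k\}$, then $\xi_{k+1}=\underline{\infty}$. Otherwise let $(x_k,y_k)$ be the first point where it meets $\partial{\mathcal D}$ again; then $\xi_{k+1}=(2A,g(2A))$ if $x_k=A$, and $\xi_{k+1}=(x_k,y_k)$ if $x_k\neq A$. Write $\xi_n^{(1)}$ for the first coordinate of $\xi_n$ and $\sigma_A=\inf\{n\ge 0:\xi_n^{(1)}\le 2A\}$, with $\inf\emptyset=+\infty$. The process $\xi$ is called recurrent if ${\mathbf P}[\sigma_A<\infty]=1$; a recurrent $\xi$ is called positive-recurrent if ${\mathbf E}[\sigma_A]<\infty$ and null-recurrent if ${\mathbf E}[\sigma_A]=\infty$. Then there exists $A_0\in(0,\infty)$, depending only on $g$ and the law of $\alpha$, such that for all $A\ge 1$ with $A>A_0$ and all $\xi_0\in\partial{\mathcal D}$ with $\xi_0^{(1)}>2A$: (i) $\xi$ is positive-recurrent if $\gamma<-{\mathbf E}[\tan^2\alpha]$; (ii) $\xi$ is null-recurrent if $\gamma>-{\mathbf E}[\tan^2\alpha]$. -/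

import Mathlib

open MeasureTheory ProbabilityTheory Filter Topology Set
open scoped ENNReal Asymptotics

noncomputable section

namespace StochasticBilliard

/-- The tube `{(x, y) : x > A, |y| < g x}`. -/
def tube (g : ℝ → ℝ) (A : ℝ) : Set (ℝ × ℝ) :=
  {p | A < p.1 ∧ |p.2| < g p.1}

/-- `k`-th derivative of `g`, regarded as a function on `[1, ∞)`. -/
def der (g : ℝ → ℝ) (k : ℕ) : ℝ → ℝ :=
  iteratedDerivWithin k g (Ici 1)

/-- Assumption (A1) with exponent `γ` on the function `g : [1, ∞) → (0, ∞)`.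
Only the values of `g` on `[1, ∞)` are used. -/
structure RegularTube (g : ℝ → ℝ) (γ : ℝ) : Prop where
  pos : ∀ x ∈ Ici (1 : ℝ), 0 < g x
  monotonic : MonotoneOn g (Ici 1) ∨ AntitoneOn g (Ici 1)
  /-- `g`, `g'` and `g''` are differentiable on `[1, ∞)`. -/
  thrice_differentiable : ∀ k < 3, DifferentiableOn ℝ (der g k) (Ici 1)
  exponent_lt_one : γ < 1
  /-- `g(x) = x ^ (γ + o(1))`. -/
  growth : ∃ e : ℝ → ℝ, Tendsto e atTop (𝓝 0) ∧ ∀ᶠ x in atTop, g x = x ^ (γ + e x)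
  /-- `g'(x) = [γ + o(1)] g(x) / x`. -/
  first : ∃ e : ℝ → ℝ, Tendsto e atTop (𝓝 0) ∧
    ∀ᶠ x in atTop, der g 1 x = (γ + e x) * (g x / x)
  /-- `g''(x) = [γ (γ - 1) + o(1)] g(x) / x ^ 2`. -/
  second : ∃ e : ℝ → ℝ, Tendsto e atTop (𝓝 0) ∧
    ∀ᶠ x in atTop, der g 2 x = (γ * (γ - 1) + e x) * (g x / x ^ 2)
  /-- `|g'''(x)| = o(x ^ (-2))`. -/
  third : (fun x => |der g 3 x|) =o[atTop] (fun x : ℝ => 1 / x ^ 2)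

/-- The law `μ` of the reflection angle is symmetric about `0` and is carried by
`(-α₀, α₀)` for some `α₀ ∈ (0, π/2)`. -/
def IsReflectionLaw (μ : Measure ℝ) : Prop :=
  (∃ α₀ ∈ Ioo (0 : ℝ) (Real.pi / 2), ∀ᵐ a ∂μ, |a| < α₀) ∧
    ∀ x : ℝ, μ (Ici x) = μ (Iic (-x))

/-- Interior unit normal to the boundary of the tube at `p = (x, ± g x)`, `x > A`:
proportional to `(g' x, -1)` on the upper curve and to `(g' x, 1)` on the lower one. -/
def normal (g : ℝ → ℝ) (p : ℝ × ℝ) : ℝ × ℝ :=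
  (1 / √(1 + der g 1 p.1 ^ 2)) • (der g 1 p.1, -(SignType.sign p.2 : ℝ))

/-- Unit tangent at `p = (x, ± g x)`, `x > A`, pointing to the right. -/
def tangent (g : ℝ → ℝ) (p : ℝ × ℝ) : ℝ × ℝ :=
  (1 / √(1 + der g 1 p.1 ^ 2)) • (1, (SignType.sign p.2 : ℝ) * der g 1 p.1)

/-- Unit vector at angle `a` to the interior normal at `p`, a positive angle being to the right
of the normal. -/
def rayDirection (g : ℝ → ℝ) (p : ℝ × ℝ) (a : ℝ) : ℝ × ℝ :=
  Real.cos a • normal g p + Real.sin a • tangent g p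

/-- The parameters `t > 0` at which the ray from `p` at angle `a` meets the boundary of the tube. -/
def hitTimes (g : ℝ → ℝ) (A : ℝ) (p : ℝ × ℝ) (a : ℝ) : Set ℝ :=
  {t | 0 < t ∧ p + t • rayDirection g p a ∈ frontier (tube g A)}

/-- The first point where the ray from `p` at angle `a` meets the boundary of the tube again. -/
def firstHit (g : ℝ → ℝ) (A : ℝ) (p : ℝ × ℝ) (a : ℝ) : ℝ × ℝ :=
  p + sInf (hitTimes g A p a) • rayDirection g p a

open scoped Classical in
/-- One step of the collisions process with angle `a`. The value `none` is the absorbing state at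
infinity; a ray that hits the vertical boundary `x = A` is sent to `(2A, g(2A))`. -/
def step (g : ℝ → ℝ) (A : ℝ) (a : ℝ) : Option (ℝ × ℝ) → Option (ℝ × ℝ)
  | none => none
  | some p =>
      if hitTimes g A p a = ∅ then none
      else if (firstHit g A p a).1 = A then some (2 * A, g (2 * A))
      else some (firstHit g A p a)

/-- The collisions process started at `p₀` and driven by the sequence of angles `a`. -/
def collisions (g : ℝ → ℝ) (A : ℝ) (p₀ : ℝ × ℝ) (a : ℕ → ℝ) : ℕ → Option (ℝ × ℝ)
  | 0 => some p₀
  | n + 1 => step g A (a n) (collisions g A p₀ a n)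

/-- `inf {n ≥ 0 : ξₙ⁽¹⁾ ≤ 2A}` for a trajectory `ξ`, with `inf ∅ = ∞`. -/
def returnTime (A : ℝ) (ξ : ℕ → Option (ℝ × ℝ)) : ℕ∞ :=
  sInf {m : ℕ∞ | ∃ n : ℕ, m = n ∧ ∃ p, ξ n = some p ∧ p.1 ≤ 2 * A}

variable {Ω : Type*} [MeasurableSpace Ω]

/-- The process returns almost surely. -/
def Recurrent (P : Measure Ω) (A : ℝ) (ξ : Ω → ℕ → Option (ℝ × ℝ)) : Prop :=
  P {ω | returnTime A (ξ ω) < ⊤} = 1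

/-- Recurrent with finite mean return time. -/
def PositiveRecurrent (P : Measure Ω) (A : ℝ) (ξ : Ω → ℕ → Option (ℝ × ℝ)) : Prop :=
  Recurrent P A ξ ∧ ∫⁻ ω, (returnTime A (ξ ω) : ℝ≥0∞) ∂P < ∞

/-- Recurrent with infinite mean return time. -/
def NullRecurrent (P : Measure Ω) (A : ℝ) (ξ : Ω → ℕ → Option (ℝ × ℝ)) : Prop :=
  Recurrent P A ξ ∧ ∫⁻ ω, (returnTime A (ξ ω) : ℝ≥0∞) ∂P = ∞

end StochasticBilliard

end

/-! Far out the tube is thin and flat, so a ray from abscissa `x > 2A` always crosses to the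
opposite curve and lands beyond `A`. Before the return, neither the vertical side nor the absorbing
state plays a role, and the abscissa follows a one-dimensional Markov chain `x ↦ F x a`, where `F`
does not depend on `A`.

Put `r = g x / x`, `u = tan a` and `v = E[tan² α]`. The landing equation gives `(F x a - x) / g x =
2u + 2γr(1 + 2u²) + o(r)`, uniformly in the admissible angles. Since `tan α` has mean zero, the mean
of `(F x α) ^ p` is `x ^ p * (1 + driftCoeff γ v p * r² + o(r²))`
(`IsLanding.eventually_abs_drift_le`). As `x ^ p * r²` equals `x ^ (p - 2 + 2γ + o(1))`, the drift
has order one near `p = 2 - 2γ`, and there the coefficient is `2p(γ + v)`. The sign of `γ + v`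
therefore decides.

If `γ + v < 0`, some `q > 2 - 2γ` still has negative coefficient, so `x ^ q` has drift at most `-1`
and Foster's criterion bounds the mean return time.

If `γ + v > 0`, the function `x ^ (1/2)` has negative drift because `γ ≤ 0 < v`, which gives
recurrence. For the infinite mean, take `p < q < 2 - 2γ` with positive coefficient at `p`: then `x ^
p` has nonnegative drift and `x ^ q` has drift at most `1`, so the positive part of `M (x ^ p - B ^
p) - x ^ q` has drift at least `-1` for every `M ≥ 0`. It is bounded and vanishes at and below `B`,
so its initial value is a lower bound for the mean return time, and `M` is arbitrary. -/

namespace StochasticBilliard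

/-! ### Regularity of the width function -/

section Regularity

variable {g : ℝ → ℝ} {γ : ℝ}

theorem der_zero (g : ℝ → ℝ) : der g 0 = g := iteratedDerivWithin_zero

theorem RegularTube.continuousOn (hg : RegularTube g γ) : ContinuousOn g (Ici 1) := by
  have h := (hg.thrice_differentiable 0 (by norm_num)).continuousOn
  rwa [der_zero] at h

theorem RegularTube.continuousOn_der (hg : RegularTube g γ) : ContinuousOn (der g 1) (Ici 1) :=
  (hg.thrice_differentiable 1 (by norm_num)).continuousOn

theorem RegularTube.hasDerivWithinAt (hg : RegularTube g γ) {x : ℝ} (hx : 1 ≤ x) :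
    HasDerivWithinAt g (der g 1 x) (Ici 1) x := by
  have h := (hg.thrice_differentiable 0 (by norm_num)) x hx
  rw [der_zero] at h
  have := h.hasDerivWithinAt
  rwa [← iteratedDerivWithin_one] at this

theorem RegularTube.hasDerivAt (hg : RegularTube g γ) {x : ℝ} (hx : 1 < x) :
    HasDerivAt g (der g 1 x) x :=
  (hg.hasDerivWithinAt hx.le).hasDerivAt (Ici_mem_nhds hx)

theorem RegularTube.abs_sub_le (hg : RegularTube g γ) {A η : ℝ} (hA : 1 ≤ A)
    (hη : ∀ y, A ≤ y → |der g 1 y| ≤ η) {y z : ℝ} (hy : A ≤ y) (hz : A ≤ z) :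
    |g z - g y| ≤ η * |z - y| := by
  have h := Convex.norm_image_sub_le_of_norm_hasDerivWithin_le (f := g) (f' := der g 1)
    (s := Ici A) (C := η)
    (fun x hx => (hg.hasDerivWithinAt (hA.trans hx)).mono (Ici_subset_Ici.2 hA))
    (fun x hx => hη x hx) (convex_Ici A) (mem_Ici.2 hy) (mem_Ici.2 hz)
  simpa [Real.norm_eq_abs] using h

/-- The function `g` is arbitrary to the left of `1`; freezing it there yields globally continuous,
hence measurable, functions. -/
theorem continuous_comp_max {f : ℝ → ℝ} (hf : ContinuousOn f (Ici 1)) :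
    Continuous fun x => f (max x 1) :=
  hf.comp_continuous (by fun_prop) (fun x => mem_Ici.2 (le_max_right _ _))

end Regularity

/-! ### The curved boundary of the tube -/

section Frontier

variable {g : ℝ → ℝ} {γ A : ℝ}

theorem tube_eq (hA : 1 ≤ A) :
    tube g A = {p : ℝ × ℝ | A < p.1} ∩ {p | |p.2| < g (max p.1 1)} := by
  ext p
  simp only [tube, mem_ofPred_eq, mem_inter_iff]
  refine and_congr_right fun h => ?_
  rw [max_eq_left (hA.trans h.le)]

theorem RegularTube.isOpen_tube (hg : RegularTube g γ) (hA : 1 ≤ A) : IsOpen (tube g A) := by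
  rw [tube_eq hA]
  have h := continuous_comp_max hg.continuousOn
  exact (isOpen_lt continuous_const continuous_fst).inter
    (isOpen_lt (by fun_prop) (h.comp continuous_fst))

theorem RegularTube.mem_frontier_tube_iff (hg : RegularTube g γ) (hA : 1 ≤ A) {p : ℝ × ℝ}
    (hp : A < p.1) : p ∈ frontier (tube g A) ↔ |p.2| = g p.1 := by
  have hcont := continuous_comp_max hg.continuousOn
  have hmax : max p.1 1 = p.1 := max_eq_left (hA.trans hp.le)
  rw [(hg.isOpen_tube hA).frontier_eq, Set.mem_sdiff]
  constructor
  · rintro ⟨h1, h2⟩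
    have h3 : |p.2| ≤ g (max p.1 1) := by
      have : p ∈ closure {p : ℝ × ℝ | |p.2| < g (max p.1 1)} :=
        closure_mono (by rw [tube_eq hA]; exact inter_subset_right) h1
      exact closure_lt_subset_le (f := fun p : ℝ × ℝ => |p.2|) (by fun_prop)
        (hcont.comp continuous_fst) this
    rw [hmax] at h3
    by_contra h4
    exact h2 ⟨hp, lt_of_le_of_ne h3 h4⟩
  · intro h
    refine ⟨?_, fun h2 => absurd h2.2 (by rw [h]; exact lt_irrefl _)⟩
    have hlim : Tendsto (fun t : ℝ => (p.1, t * p.2)) (𝓝[<] 1) (𝓝 p) := by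
      have : Tendsto (fun t : ℝ => (p.1, t * p.2)) (𝓝 1) (𝓝 (p.1, 1 * p.2)) :=
        Continuous.tendsto (by fun_prop) 1
      rw [one_mul] at this
      exact this.mono_left nhdsWithin_le_nhds
    refine mem_closure_of_tendsto hlim ?_
    have hpos := hg.pos p.1 (hA.trans hp.le)
    filter_upwards [Ioo_mem_nhdsLT (show (0 : ℝ) < 1 by norm_num)] with t ht
    refine ⟨hp, ?_⟩
    rw [abs_mul, h, abs_of_pos ht.1]
    nlinarith [ht.2]

end Frontier

/-! ### Geometry of one collision -/

section Landing

variable {g : ℝ → ℝ} {γ : ℝ}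

/-- Sum of the heights of the tube at `x` and at the abscissa reached by the ray from `(x, g x)` at
angle `a` with parameter `s`, minus the vertical distance travelled. -/
noncomputable def gap (g : ℝ → ℝ) (s x a : ℝ) : ℝ :=
  g (max (x + s * (Real.tan a + der g 1 (max x 1))) 1) + g (max x 1)
    - s * (1 - der g 1 (max x 1) * Real.tan a)

theorem measurable_tan : Measurable Real.tan := by
  have : Real.tan = fun x => Real.sin x / Real.cos x := funext Real.tan_eq_sin_div_cos
  rw [this]
  exact Real.measurable_sin.div Real.measurable_cos

theorem RegularTube.measurable_gap (hg : RegularTube g γ) (s : ℝ) :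
    Measurable fun p : ℝ × ℝ => gap g s p.1 p.2 := by
  have h0 := (continuous_comp_max hg.continuousOn).measurable
  have h1 := (continuous_comp_max hg.continuousOn_der).measurable
  have ht := measurable_tan
  have e1 : Measurable fun p : ℝ × ℝ => der g 1 (max p.1 1) := h1.comp measurable_fst
  have e2 : Measurable fun p : ℝ × ℝ => Real.tan p.2 := ht.comp measurable_snd
  have e3 : Measurable fun p : ℝ × ℝ => g (max p.1 1) := h0.comp measurable_fst
  have e4 : Measurable fun p : ℝ × ℝ => p.1 + s * (Real.tan p.2 + der g 1 (max p.1 1)) :=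
    measurable_fst.add ((e2.add e1).const_mul s)
  exact ((h0.comp e4).add e3).sub ((measurable_const.sub (e1.mul e2)).const_mul s)

theorem RegularTube.continuous_gap (hg : RegularTube g γ) (x a : ℝ) :
    Continuous fun s => gap g s x a := by
  have h0 := continuous_comp_max hg.continuousOn
  have : Continuous fun s => g (max (x + s * (Real.tan a + der g 1 (max x 1))) 1) :=
    h0.comp (f := fun s => x + s * (Real.tan a + der g 1 (max x 1))) (by fun_prop)
  exact (this.add continuous_const).sub (by fun_prop)

/-- Beyond abscissa `X` the tube is thin and flat compared with a bound `U` for `|tan α|`. -/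
structure Flat (g : ℝ → ℝ) (U X η : ℝ) : Prop where
  one_le : 1 ≤ X
  nonneg : 0 ≤ U
  four_mul_le : 4 * (U + 1) ≤ X
  slope_le : η * (U + 1) ≤ 1 / 4
  abs_der_le : ∀ y, X ≤ y → |der g 1 y| ≤ η
  width_le : ∀ y, X ≤ y → g y ≤ 1

namespace Flat

variable {U X η x a : ℝ}

theorem mono (h : Flat g U X η) {A : ℝ} (hA : X ≤ A) : Flat g U A η :=
  ⟨h.one_le.trans hA, h.nonneg, h.four_mul_le.trans hA, h.slope_le,
    fun y hy => h.abs_der_le y (hA.trans hy), fun y hy => h.width_le y (hA.trans hy)⟩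

theorem eta_nonneg (h : Flat g U X η) : 0 ≤ η := (abs_nonneg _).trans (h.abs_der_le X le_rfl)

theorem eta_le (h : Flat g U X η) : η ≤ 1 / 4 := by
  nlinarith [h.eta_nonneg, h.slope_le, h.nonneg]

theorem abs_horizontal_le (h : Flat g U X η) (hx : X ≤ x) (ha : |Real.tan a| ≤ U) :
    |Real.tan a + der g 1 x| ≤ U + 1 := by
  have := h.abs_der_le x hx
  have := h.eta_le
  exact (abs_add_le _ _).trans (by linarith)

theorem le_vertical (h : Flat g U X η) (hx : X ≤ x) (ha : |Real.tan a| ≤ U) :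
    3 / 4 ≤ 1 - der g 1 x * Real.tan a := by
  have h1 : |der g 1 x * Real.tan a| ≤ η * U := by
    rw [abs_mul]
    exact mul_le_mul (h.abs_der_le x hx) ha (abs_nonneg _) h.eta_nonneg
  have := h.slope_le
  have := h.eta_nonneg
  have := le_abs_self (der g 1 x * Real.tan a)
  linarith

/-- The parameter `s` is the ray length rescaled so that the horizontal displacement is `s (tan a +
g')` and the vertical one `s (1 - g' tan a)`. For `s ≤ 4` the former is at most `4 (U + 1) ≤ X`, so
a ray from beyond `2X` cannot reach the vertical side. -/
theorem lt_add (h : Flat g U X η) (hx : 2 * X < x) (ha : |Real.tan a| ≤ U) {s : ℝ}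
    (hs : s ∈ Icc (0 : ℝ) 4) : X < x + s * (Real.tan a + der g 1 x) := by
  have hX := h.one_le
  have h1 := (abs_le.1 (h.abs_horizontal_le (x := x) (by linarith) ha)).1
  have h2 := h.four_mul_le
  have h3 := h.nonneg
  have h4 : -(4 * (U + 1)) ≤ s * (Real.tan a + der g 1 x) := by
    nlinarith [hs.1, hs.2]
  linarith

theorem gap_eq (h : Flat g U X η) (hx : 2 * X < x) (ha : |Real.tan a| ≤ U) {s : ℝ}
    (hs : s ∈ Icc (0 : ℝ) 4) : gap g s x a =
      g (x + s * (Real.tan a + der g 1 x)) + g x - s * (1 - der g 1 x * Real.tan a) := by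
  have hX := h.one_le
  have h1 : max x 1 = x := max_eq_left (by linarith)
  have h2 := h.lt_add hx ha hs
  rw [gap, h1, max_eq_left (by linarith)]

theorem abs_sub_le (h : Flat g U X η) (hg : RegularTube g γ) (hx : 2 * X < x)
    (ha : |Real.tan a| ≤ U) {s t : ℝ} (hs : s ∈ Icc (0 : ℝ) 4) (ht : t ∈ Icc (0 : ℝ) 4) :
    |g (x + s * (Real.tan a + der g 1 x)) - g (x + t * (Real.tan a + der g 1 x))|
      ≤ 1 / 4 * |s - t| := by
  have h1 := hg.abs_sub_le h.one_le h.abs_der_le (h.lt_add hx ha ht).le (h.lt_add hx ha hs).le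
  have hX := h.one_le
  have h2 := h.abs_horizontal_le (x := x) (by linarith) ha
  have h3 := h.slope_le
  refine h1.trans ?_
  have : x + s * (Real.tan a + der g 1 x) - (x + t * (Real.tan a + der g 1 x))
    = (s - t) * (Real.tan a + der g 1 x) := by ring
  rw [this, abs_mul]
  calc η * (|s - t| * |Real.tan a + der g 1 x|) ≤ η * (|s - t| * (U + 1)) := by
        have := h.eta_nonneg
        gcongr
    _ = (η * (U + 1)) * |s - t| := by ring
    _ ≤ _ := by gcongr

/-- Along the ray `g` varies at rate at most `1/4`, while the vertical distance grows at rate at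
least `3/4`. -/
theorem gap_strictAntiOn (h : Flat g U X η) (hg : RegularTube g γ) (hx : 2 * X < x)
    (ha : |Real.tan a| ≤ U) : StrictAntiOn (fun s => gap g s x a) (Icc 0 4) := by
  intro s hs t ht hst
  have hX := h.one_le
  have h1 := (abs_le.1 (h.abs_sub_le hg hx ha ht hs)).2
  have h2 := h.le_vertical (x := x) (by linarith) ha
  rw [abs_of_pos (sub_pos.2 hst)] at h1
  simp only [h.gap_eq hx ha hs, h.gap_eq hx ha ht]
  nlinarith

/-- The bound `4` suffices because the vertical distance is then at least `3`, whereas the two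
half-widths sum to at most `2`. -/
theorem exists_gap_eq_zero (h : Flat g U X η) (hg : RegularTube g γ) (hx : 2 * X < x)
    (ha : |Real.tan a| ≤ U) : ∃ s ∈ Ioo (0 : ℝ) 4, gap g s x a = 0 := by
  have hX := h.one_le
  have h0 : 0 < gap g 0 x a := by
    rw [h.gap_eq hx ha ⟨le_rfl, by norm_num⟩]
    have := hg.pos x (by simp; linarith)
    simp [this]
  have h4 : gap g 4 x a < 0 := by
    rw [h.gap_eq hx ha ⟨by norm_num, le_rfl⟩]
    have h1 := h.width_le x (by linarith)
    have h2 := h.width_le _ (h.lt_add hx ha ⟨by norm_num, le_refl (4 : ℝ)⟩).le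
    have h3 := h.le_vertical (x := x) (by linarith) ha
    linarith
  obtain ⟨s, hs, hs0⟩ := intermediate_value_Ioo' (by norm_num : (0 : ℝ) ≤ 4)
    (hg.continuous_gap x a).continuousOn ⟨h4, h0⟩
  exact ⟨s, hs, hs0⟩

/-- The parameter at which a ray meets the opposite side of the tube, as a measurable function. -/
theorem exists_measurable_hit (h : Flat g U X η) (hg : RegularTube g γ) :
    ∃ S : ℝ × ℝ → ℝ, Measurable S ∧ ∀ x a, 2 * X < x → |Real.tan a| ≤ U →
      S (x, a) ∈ Ioo (0 : ℝ) 4 ∧ gap g (S (x, a)) x a = 0 := by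
  classical
  set E : Set (ℝ × ℝ) := {p | 2 * X < p.1 ∧ |Real.tan p.2| ≤ U} with hE
  have hEm : MeasurableSet E :=
    (measurableSet_lt measurable_const measurable_fst).inter
      (measurableSet_le (measurable_tan.comp measurable_snd).abs measurable_const)
  have hex : ∀ p : ℝ × ℝ, ∃ s : ℝ, (p ∈ E → s ∈ Ioo (0 : ℝ) 4 ∧ gap g s p.1 p.2 = 0) ∧
      (p ∉ E → s = 0) := by
    intro p
    by_cases hp : p ∈ E
    · obtain ⟨s, hs, hs0⟩ := h.exists_gap_eq_zero hg hp.1 hp.2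
      exact ⟨s, fun _ => ⟨hs, hs0⟩, fun hn => absurd hp hn⟩
    · exact ⟨0, fun hn => absurd hn hp, fun _ => rfl⟩
  choose S hS1 hS2 using hex
  refine ⟨S, measurable_of_Iic fun s => ?_, fun x a hx ha => hS1 (x, a) ⟨hx, ha⟩⟩
  -- By strict monotonicity of the gap, `S p ≤ s` means that the gap at `s` is already nonpositive;
  -- this turns sublevel sets of the root into measurable sets.
  have : S ⁻¹' Iic s = (Eᶜ ∩ {_p | 0 ≤ s}) ∪
      (E ∩ ({_p | 4 ≤ s} ∪ ({_p | 0 ≤ s} ∩ {p | gap g s p.1 p.2 ≤ 0}))) := by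
    ext p
    simp only [mem_preimage, mem_Iic, mem_union, mem_inter_iff, mem_compl_iff, mem_ofPred_eq]
    by_cases hp : p ∈ E
    · obtain ⟨hs, hs0⟩ := hS1 p hp
      simp only [hp, not_true_eq_false, false_and, true_and, false_or]
      rcases le_or_gt 4 s with h4 | h4
      · simp only [h4, true_or, iff_true]
        linarith [hs.2]
      · simp only [not_le.2 h4, false_or]
        rcases lt_or_ge s 0 with h5 | h5
        · simp only [not_le.2 h5, false_and, iff_false, not_le]
          linarith [hs.1]
        · simp only [h5, true_and]
          rw [← hs0, (h.gap_strictAntiOn hg hp.1 hp.2).le_iff_ge ⟨h5, h4.le⟩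
            ⟨hs.1.le, hs.2.le⟩]
    · simp [hp, hS2 p hp]
  rw [this]
  refine (hEm.compl.inter (MeasurableSet.const _)).union (hEm.inter ((MeasurableSet.const _).union
    ((MeasurableSet.const _).inter (measurableSet_le (hg.measurable_gap s) measurable_const))))

theorem step_eq (h : Flat g U X η) (hg : RegularTube g γ) (hx : 2 * X < x)
    (ha : |Real.tan a| ≤ U) (hcos : 0 < Real.cos a) {p : ℝ × ℝ} (hp : p.1 = x)
    (hpy : |p.2| = g x) {s : ℝ} (hs : s ∈ Ioo (0 : ℝ) 4) (hs0 : gap g s x a = 0) :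
    ∃ q : ℝ × ℝ, step g X a (some p) = some q ∧ q.1 = x + s * (Real.tan a + der g 1 x) ∧
      |q.2| = g q.1 := by
  have hX := h.one_le
  have hgx : 0 < g x := hg.pos x (by simp; linarith)
  obtain ⟨σ, hσ, hpσ, hsgn⟩ : ∃ σ : ℝ, |σ| = 1 ∧ p.2 = σ * g x ∧
      (SignType.sign p.2 : ℝ) = σ := by
    rcases abs_eq hgx.le |>.1 hpy with h1 | h1
    · exact ⟨1, by simp, by simp [h1], by simp [h1, hgx]⟩
    · exact ⟨-1, by simp, by simp [h1], by simp [h1, hgx]⟩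
  set u := Real.tan a with hu
  set d := der g 1 x with hd
  set c := Real.cos a * (1 / √(1 + d ^ 2)) with hc
  have hc0 : 0 < c := by positivity
  have hsin : Real.sin a = u * Real.cos a := (Real.tan_mul_cos hcos.ne').symm
  -- With `σ` the sign of the ordinate, both sides of the tube are treated at once; `t * c` is the
  -- rescaled parameter.
  have hdir : ∀ t : ℝ, p + t • rayDirection g p a =
      (x + t * c * (u + d), σ * (g x - t * c * (1 - d * u))) := by
    intro t
    ext
    · simp only [rayDirection, normal, tangent, hp, ← hd, hsin, Prod.fst_add, Prod.smul_fst,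
        smul_eq_mul, hc]
      ring
    · simp only [rayDirection, normal, tangent, hp, ← hd, hsin, Prod.snd_add, Prod.smul_snd,
        smul_eq_mul, hsgn, hc]
      rw [hpσ]
      ring
  have hzero := hs0
  rw [h.gap_eq hx ha ⟨hs.1.le, hs.2.le⟩, ← hu, ← hd] at hzero
  have hlt := h.lt_add hx ha (s := s) ⟨hs.1.le, hs.2.le⟩
  have hgs : 0 < g (x + s * (u + d)) := hg.pos _ (by simp only [mem_Ici]; linarith)
  have hq : |σ * (g x - s * (1 - d * u))| = g (x + s * (u + d)) := by
    have : g x - s * (1 - d * u) = - g (x + s * (u + d)) := by linarith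
    rw [abs_mul, hσ, one_mul, this, abs_neg, abs_of_pos hgs]
  have hleast : IsLeast (hitTimes g X p a) (s / c) := by
    have hsc : s / c * c = s := div_mul_cancel₀ _ hc0.ne'
    constructor
    · refine ⟨div_pos hs.1 hc0, ?_⟩
      rw [hdir, hsc]
      exact (hg.mem_frontier_tube_iff hX hlt).2 hq
    -- Before the root the ray is strictly inside: the positive gap keeps it off the opposite curve,
    -- and the flatness of `g` keeps it off the curve it left.
    · rintro t ⟨ht0, ht⟩
      by_contra! hts
      have ht' : t * c < s := by rwa [lt_div_iff₀ hc0] at hts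
      have htc : 0 < t * c := by positivity
      have htI : t * c ∈ Icc (0 : ℝ) 4 := ⟨htc.le, by linarith [hs.2]⟩
      rw [hdir] at ht
      have hA := h.lt_add hx ha htI
      have h1 := (hg.mem_frontier_tube_iff hX hA).1 ht
      simp only [abs_mul, hσ, one_mul] at h1
      have h2 := h.gap_strictAntiOn hg hx ha htI ⟨hs.1.le, hs.2.le⟩ ht'
      simp only [hs0, h.gap_eq hx ha htI, ← hu, ← hd] at h2
      have h3 := (abs_le.1 (h.abs_sub_le hg hx ha htI ⟨le_rfl, by norm_num⟩)).1
      simp only [zero_mul, add_zero, sub_zero, abs_of_pos htc, ← hu, ← hd] at h3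
      have h4 := h.le_vertical (x := x) (by linarith) ha
      simp only [← hu, ← hd] at h4
      have : |g x - t * c * (1 - d * u)| < g (x + t * c * (u + d)) := by
        rw [abs_lt]
        constructor
        · linarith
        · nlinarith
      exact this.ne h1
  have hfirst : firstHit g X p a = (x + s * (u + d), σ * (g x - s * (1 - d * u))) := by
    rw [firstHit, hleast.csInf_eq, hdir, div_mul_cancel₀ _ hc0.ne']
  refine ⟨firstHit g X p a, ?_, ?_, ?_⟩
  · rw [step, if_neg (nonempty_iff_ne_empty.1 ⟨_, hleast.1⟩), if_neg]
    rw [hfirst]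
    exact hlt.ne'
  · rw [hfirst]
  · rw [hfirst]
    exact hq

end Flat

/-- `F x a` is the abscissa of the collision which follows one at abscissa `x` with angle `a`. -/
structure IsLanding (g : ℝ → ℝ) (U X : ℝ) (F : ℝ → ℝ → ℝ) : Prop where
  measurable : Measurable (Function.uncurry F)
  lt : ∀ A x a, X ≤ A → 2 * A < x → |Real.tan a| ≤ U → A < F x a
  eq : ∀ x a, 2 * X < x → |Real.tan a| ≤ U →
    F x a - x = (g x + g (F x a)) * ((Real.tan a + der g 1 x) / (1 - der g 1 x * Real.tan a))
  step : ∀ A x a, X ≤ A → 2 * A < x → |Real.tan a| ≤ U → 0 < Real.cos a → ∀ p : ℝ × ℝ,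
    p.1 = x → |p.2| = g x →
      ∃ q : ℝ × ℝ, StochasticBilliard.step g A a (some p) = some q ∧ q.1 = F x a ∧ |q.2| = g q.1

theorem Flat.exists_isLanding {U X η : ℝ} (h : Flat g U X η) (hg : RegularTube g γ) :
    ∃ F, IsLanding g U X F := by
  obtain ⟨S, hSm, hS⟩ := h.exists_measurable_hit hg
  have hX := h.one_le
  have hmax : ∀ x, 2 * X < x → max x 1 = x := fun x hx => max_eq_left (by linarith)
  refine ⟨fun x a => x + S (x, a) * (Real.tan a + der g 1 (max x 1)), ?_, ?_, ?_, ?_⟩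
  · have h1 := (continuous_comp_max hg.continuousOn_der).measurable
    have e1 : Measurable fun p : ℝ × ℝ => der g 1 (max p.1 1) := h1.comp measurable_fst
    have e2 : Measurable fun p : ℝ × ℝ => Real.tan p.2 := measurable_tan.comp measurable_snd
    exact measurable_fst.add (hSm.mul (e2.add e1))
  · intro A x a hA hx ha
    have hx' : 2 * X < x := by linarith
    have hs := (hS x a hx' ha).1
    simp only [hmax x hx']
    exact (h.mono hA).lt_add hx ha ⟨hs.1.le, hs.2.le⟩
  · intro x a hx ha
    obtain ⟨hs, hs0⟩ := hS x a hx ha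
    have hv := h.le_vertical (x := x) (by linarith) ha
    rw [h.gap_eq hx ha ⟨hs.1.le, hs.2.le⟩] at hs0
    simp only [hmax x hx]
    have h3 : g x + g (x + S (x, a) * (Real.tan a + der g 1 x))
      = S (x, a) * (1 - der g 1 x * Real.tan a) := by linarith
    have hv' : 1 - der g 1 x * Real.tan a ≠ 0 := by linarith
    rw [h3, add_sub_cancel_left, mul_assoc, mul_div_cancel₀ _ hv']
  · intro A x a hA hx ha hcos p hp hpy
    have hx' : 2 * X < x := by linarith
    obtain ⟨hs, hs0⟩ := hS x a hx' ha
    simp only [hmax x hx']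
    exact (h.mono hA).step_eq hg hx ha hcos hp hpy hs hs0

end Landing

/-! ### Second-order expansion of the displacement -/

section Expansion

theorem rpow_one_add_isLittleO (p : ℝ) :
    (fun z : ℝ => (1 + z) ^ p - 1 - p * z - p * (p - 1) / 2 * z ^ 2) =o[𝓝 0] fun z => z ^ 2 := by
  have hconv : Convex ℝ (Ioi (-1 : ℝ)) := convex_Ioi _
  have hmem : (0 : ℝ) ∈ Ioi (-1 : ℝ) := by simp
  have hcd : ContDiffOn ℝ (2 : ℕ) (fun z : ℝ => (1 + z) ^ p) (Ioi (-1)) := by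
    intro z hz
    have : (1 + z) ≠ 0 := by have := mem_Ioi.1 hz; linarith
    exact ((contDiffAt_const.add contDiffAt_id).rpow_const_of_ne this).contDiffWithinAt
  have h := taylor_isLittleO hconv hmem hcd
  rw [(isOpen_Ioi).nhdsWithin_eq hmem] at h
  have hu : UniqueDiffOn ℝ (Ioi (-1 : ℝ)) := isOpen_Ioi.uniqueDiffOn
  have hd : ∀ (q : ℝ), ∀ z ∈ Ioi (-1 : ℝ),
      HasDerivAt (fun z : ℝ => (1 + z) ^ q) (q * (1 + z) ^ (q - 1)) z := by
    intro q z hz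
    have : (1 + z) ≠ 0 := by have := mem_Ioi.1 hz; linarith
    have h1 := ((hasDerivAt_id z).const_add 1).rpow_const (p := q) (Or.inl this)
    simpa using h1
  have h1 : ∀ z ∈ Ioi (-1 : ℝ), iteratedDerivWithin 1 (fun z : ℝ => (1 + z) ^ p) (Ioi (-1)) z
      = p * (1 + z) ^ (p - 1) := by
    intro z hz
    rw [iteratedDerivWithin_one]
    exact (hd p z hz).hasDerivWithinAt.derivWithin (hu z hz)
  have h2 : iteratedDerivWithin 2 (fun z : ℝ => (1 + z) ^ p) (Ioi (-1)) 0 = p * (p - 1) := by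
    rw [iteratedDerivWithin_succ, derivWithin_congr h1 (h1 0 hmem),
      ((hd (p - 1) 0 hmem).const_mul p).hasDerivWithinAt.derivWithin (hu 0 hmem)]
    simp
  have hT : ∀ z : ℝ, taylorWithinEval (fun z : ℝ => (1 + z) ^ p) 2 (Ioi (-1)) 0 z
      = 1 + p * z + p * (p - 1) / 2 * z ^ 2 := by
    intro z
    rw [taylorWithinEval_succ, taylorWithinEval_succ, taylor_within_zero_eval,
      show (0 + 1 : ℕ) = 1 from rfl, show (1 + 1 : ℕ) = 2 from rfl, h1 0 hmem, h2]
    simp [Nat.factorial]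
    ring
  refine (h.congr (fun z => ?_) fun z => by rw [sub_zero])
  rw [hT]
  ring

variable {ι : Type*} {l : Filter ι} {u d r δ θ w : ι → ℝ} {γ : ℝ}

/-- Second-order expansion of the relative displacement `δ` and of the powers of `1 + r δ`. -/
theorem rpow_displacement_isLittleO (p : ℝ) (hr : Tendsto r l (𝓝 0))
    (hu : u =O[l] (fun _ => (1 : ℝ))) (hδ : δ =O[l] (fun _ => (1 : ℝ)))
    (hd : (fun i => d i - γ * r i) =o[l] r)
    (hθ : (fun i => θ i - γ * r i * δ i) =o[l] r)
    (hv : (fun i => (1 - d i * u i)⁻¹) =O[l] (fun _ => (1 : ℝ)))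
    (hv0 : ∀ᶠ i in l, 1 - d i * u i ≠ 0)
    (hw : ∀ᶠ i in l, w i = (u i + d i) / (1 - d i * u i))
    (heq : ∀ᶠ i in l, δ i = (2 + θ i) * w i) :
    (fun i => (1 + r i * δ i) ^ p - 1 - 2 * p * (r i * u i)
      - 2 * p * r i ^ 2 * (γ * (1 + 2 * u i ^ 2) + (p - 1) * u i ^ 2)) =o[l] fun i => r i ^ 2 := by
  have hr1 : r =o[l] (fun _ => (1 : ℝ)) := (Asymptotics.isLittleO_one_iff ℝ).2 hr
  have hrr : r =O[l] r := Asymptotics.isBigO_refl _ _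
  have hdr : d =O[l] r := by
    have := hd.isBigO.add (hrr.const_mul_left γ)
    simpa using this
  have hu2 : (fun i => 1 + u i ^ 2) =O[l] (fun _ => (1 : ℝ)) := by
    have h2 := hu.pow 2
    simp only [one_pow] at h2
    exact (Asymptotics.isBigO_refl (fun _ : ι => (1 : ℝ)) l).add h2
  -- Exactly, `w - u = d (1 + u²) / (1 - d u)`.
  have hwu : (fun i => w i - u i) =O[l] r := by
    have h1 : (fun i => d i * ((1 + u i ^ 2) * (1 - d i * u i)⁻¹)) =O[l] r := by
      simpa using hdr.mul (hu2.mul hv)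
    refine h1.congr' ?_ EventuallyEq.rfl
    filter_upwards [hv0, hw] with i h0 h2
    rw [h2]
    field_simp
    ring
  have hwd : (fun i => w i - u i - d i * (1 + u i ^ 2)) =o[l] r := by
    have h1 : (fun i => (d i * d i) * (u i * ((1 + u i ^ 2) * (1 - d i * u i)⁻¹))) =o[l] r := by
      simpa using (hdr.mul_isLittleO (hdr.trans_isLittleO hr1)).mul_isBigO (hu.mul (hu2.mul hv))
    refine h1.congr' ?_ EventuallyEq.rfl
    filter_upwards [hv0, hw] with i h0 h2
    rw [h2]
    field_simp
    ring
  have hw1 : w =O[l] (fun _ => (1 : ℝ)) := by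
    have := (hwu.trans hr1.isBigO).add hu
    simpa using this
  have hθr : θ =O[l] r := by
    have h1 := (hrr.const_mul_left γ).mul hδ
    simp only [mul_one] at h1
    simpa using hθ.isBigO.add h1
  have hδu : (fun i => δ i - 2 * u i) =O[l] r := by
    have h1 : (fun i => 2 * (w i - u i) + θ i * w i) =O[l] r := by
      have h2 := hθr.mul hw1
      simp only [mul_one] at h2
      exact (hwu.const_mul_left 2).add h2
    refine h1.congr' ?_ EventuallyEq.rfl
    filter_upwards [heq] with i h
    rw [h]
    ring
  have hδw : (fun i => (δ i - 2 * u i) * w i + 2 * u i * (w i - u i)) =O[l] r := by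
    have h1 := hδu.mul hw1
    have h2 := (hu.const_mul_left 2).mul hwu
    simp only [mul_one, one_mul] at h1 h2
    exact h1.add h2
  -- The correction has two sources: `2 (w - u)` contributes `2γr(1 + u²)`, and the change of width
  -- `θ w` contributes `2γru²`.
  have hδ2 : (fun i => δ i - 2 * u i - 2 * γ * r i * (1 + 2 * u i ^ 2)) =o[l] r := by
    have h1 : (fun i => 2 * (w i - u i - d i * (1 + u i ^ 2))
        + 2 * (d i - γ * r i) * (1 + u i ^ 2) + (θ i - γ * r i * δ i) * w i
        + γ * r i * ((δ i - 2 * u i) * w i + 2 * u i * (w i - u i))) =o[l] r := by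
      have a1 := hwd.const_mul_left 2
      have a2 := (hd.const_mul_left 2).mul_isBigO hu2
      have a3 := hθ.mul_isBigO hw1
      have a4 := (hrr.const_mul_left γ).mul_isLittleO (hδw.trans_isLittleO hr1)
      simp only [mul_one] at a2 a3 a4
      exact ((a1.add a2).add a3).add a4
    refine h1.congr' ?_ EventuallyEq.rfl
    filter_upwards [heq] with i h
    have : w i * (2 + θ i) = δ i := by rw [h]; ring
    linear_combination this
  have hz : Tendsto (fun i => r i * δ i) l (𝓝 0) := by
    have := hr1.mul_isBigO hδ
    simp only [mul_one] at this
    exact (Asymptotics.isLittleO_one_iff ℝ).1 this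
  have hz2 : (fun i => (r i * δ i) ^ 2) =O[l] fun i => r i ^ 2 := by
    have := (hrr.mul hδ).pow 2
    simpa using this
  have b1 := ((rpow_one_add_isLittleO p).comp_tendsto hz).trans_isBigO hz2
  have b2 : (fun i => p * (r i * (δ i - 2 * u i - 2 * γ * r i * (1 + 2 * u i ^ 2)))) =o[l]
      fun i => r i ^ 2 := by
    have := (hrr.mul_isLittleO hδ2).const_mul_left p
    simpa [sq] using this
  have b3 : (fun i => p * (p - 1) / 2 * (r i ^ 2 * ((δ i - 2 * u i) * (δ i + 2 * u i)))) =o[l]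
      fun i => r i ^ 2 := by
    have h1 := (hδu.trans_isLittleO hr1).mul_isBigO (hδ.add (hu.const_mul_left 2))
    have h2 := ((Asymptotics.isBigO_refl (fun i => r i ^ 2) l).mul_isLittleO h1).const_mul_left
      (p * (p - 1) / 2)
    simpa using h2
  refine ((b1.add b2).add b3).congr_left fun i => ?_
  simp only [Function.comp]
  ring

end Expansion

/-! ### Uniform asymptotics of the tube and of the landing map -/

section Tube

variable {g : ℝ → ℝ} {γ : ℝ}

theorem tendsto_div_id_of_tendsto_zero (hg0 : Tendsto g atTop (𝓝 0)) :
    Tendsto (fun x => g x / x) atTop (𝓝 0) := by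
  simpa [div_eq_mul_inv] using hg0.mul tendsto_inv_atTop_zero

theorem RegularTube.der_isLittleO (hg : RegularTube g γ) :
    (fun x => der g 1 x - γ * (g x / x)) =o[atTop] fun x => g x / x := by
  obtain ⟨e, he, h⟩ := hg.first
  have h1 : (fun x => e x * (g x / x)) =o[atTop] fun x => g x / x := by
    simpa using ((Asymptotics.isLittleO_one_iff ℝ).2 he).mul_isBigO
      (Asymptotics.isBigO_refl (fun x => g x / x) atTop)
  refine h1.congr' ?_ EventuallyEq.rfl
  filter_upwards [h] with x hx
  rw [hx]
  ring

theorem RegularTube.tendsto_der (hg : RegularTube g γ) (hg0 : Tendsto g atTop (𝓝 0)) :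
    Tendsto (der g 1) atTop (𝓝 0) := by
  have h := tendsto_div_id_of_tendsto_zero hg0
  have h1 := (hg.der_isLittleO.trans ((Asymptotics.isLittleO_one_iff ℝ).2 h))
  have h2 := ((Asymptotics.isLittleO_one_iff ℝ).1 h1).add (h.const_mul γ)
  simpa using h2

theorem RegularTube.exists_flat (hg : RegularTube g γ) (hg0 : Tendsto g atTop (𝓝 0))
    {U : ℝ} (hU : 0 ≤ U) : ∃ X, Flat g U X (1 / (4 * (U + 1))) := by
  have hη : 0 < 1 / (4 * (U + 1)) := by positivity
  have h1 : ∀ᶠ x in atTop, |der g 1 x| ≤ 1 / (4 * (U + 1)) := by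
    have := (hg.tendsto_der hg0).abs
    rw [abs_zero] at this
    exact this.eventually_le_const hη
  have h2 : ∀ᶠ x in atTop, g x ≤ 1 := hg0.eventually_le_const one_pos
  obtain ⟨X, hX⟩ := eventually_atTop.1 ((h1.and h2).and
    ((eventually_ge_atTop 1).and (eventually_ge_atTop (4 * (U + 1)))))
  refine ⟨X, (hX X le_rfl).2.1, hU, (hX X le_rfl).2.2, le_of_eq ?_, fun y hy => (hX y hy).1.1,
    fun y hy => (hX y hy).1.2⟩
  field_simp

theorem RegularTube.eventually_ratio_near (hg : RegularTube g γ) (hg0 : Tendsto g atTop (𝓝 0))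
    {C ρ : ℝ} (hC : 0 ≤ C) (hρ : 0 < ρ) :
    ∀ᶠ x in atTop, ∀ y, |y - x| ≤ C * g x → |g y / y - g x / x| ≤ ρ * (g x / x) := by
  -- The variation of `g` and that of `1 / y` each cost at most `2Cη` times the ratio.
  set η := ρ / (4 * (C + 1)) with hη
  have hη0 : 0 < η := by positivity
  have h1 : ∀ᶠ x in atTop, |der g 1 x| ≤ η := by
    have := (hg.tendsto_der hg0).abs
    rw [abs_zero] at this
    exact this.eventually_le_const hη0
  obtain ⟨Y, hY⟩ := eventually_atTop.1 h1
  have h2 := (tendsto_div_id_of_tendsto_zero hg0).eventually_le_const hη0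
  have h3 : ∀ᶠ x in atTop, C * g x ≤ 1 := by
    have := hg0.const_mul C
    rw [mul_zero] at this
    exact this.eventually_le_const one_pos
  filter_upwards [h2, h3, eventually_ge_atTop (2 * max Y 1)] with x hx2 hx3 hxY y hy
  have hm := le_max_right Y 1
  have hyx := abs_le.1 (hy.trans hx3)
  have hyY : max Y 1 ≤ y := by linarith
  have hy2 : x / 2 ≤ y := by linarith
  have hx0 : 0 < x := by linarith
  have hy0 : 0 < y := by linarith
  have hgx : 0 < g x := hg.pos x (by simp; linarith)
  have h4 := hg.abs_sub_le hm (fun z hz => hY z ((le_max_left Y 1).trans hz))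
    (show max Y 1 ≤ x by linarith) hyY
  have h5 : g y / y - g x / x = (g y - g x) / y + (g x / x) * ((x - y) / y) := by
    field_simp
    ring
  have hyinv : 1 / y ≤ 2 / x := by
    rw [div_le_div_iff₀ hy0 hx0]
    linarith
  have h6 : |(g y - g x) / y| ≤ (η * (C * g x)) * (2 / x) := by
    rw [abs_div, abs_of_pos hy0, div_eq_mul_one_div]
    refine mul_le_mul (h4.trans ?_) hyinv (by positivity) (by positivity)
    gcongr
  have h7 : |(x - y) / y| ≤ (C * g x) * (2 / x) := by
    rw [abs_div, abs_of_pos hy0, div_eq_mul_one_div, abs_sub_comm]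
    exact mul_le_mul hy hyinv (by positivity) (by positivity)
  have h8 : C * g x * (2 / x) ≤ 2 * C * η := by
    have : C * g x * (2 / x) = 2 * C * (g x / x) := by ring
    rw [this]
    gcongr
  have hr0 : 0 < g x / x := by positivity
  have h9 : 4 * C * η ≤ ρ := by
    rw [hη, mul_div_assoc', div_le_iff₀ (by positivity)]
    nlinarith
  rw [h5]
  calc |(g y - g x) / y + g x / x * ((x - y) / y)|
      ≤ |(g y - g x) / y| + |g x / x * ((x - y) / y)| := abs_add_le _ _
    _ ≤ (η * (C * g x)) * (2 / x) + g x / x * (2 * C * η) := by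
        rw [abs_mul (g x / x), abs_of_pos hr0]
        gcongr
        exact h7.trans h8
    _ = 4 * C * η * (g x / x) := by ring
    _ ≤ _ := by gcongr

/-- A jump has length `O(g x)`, so the slope is controlled on the whole window that one jump can
cross. -/
theorem RegularTube.eventually_der_near (hg : RegularTube g γ) (hg0 : Tendsto g atTop (𝓝 0))
    {C ε : ℝ} (hC : 0 ≤ C) (hε : 0 < ε) :
    ∀ᶠ x in atTop, ∀ y, |y - x| ≤ C * g x → |der g 1 y - γ * (g x / x)| ≤ ε * (g x / x) := by
  set ρ := min 1 (ε / (2 * (|γ| + 1))) with hρ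
  have hρ0 : 0 < ρ := by positivity
  have h1 := hg.der_isLittleO.def (show 0 < ε / 4 by positivity)
  obtain ⟨Y, hY⟩ := eventually_atTop.1 h1
  have h3 : ∀ᶠ x in atTop, C * g x ≤ 1 := by
    have := hg0.const_mul C
    rw [mul_zero] at this
    exact this.eventually_le_const one_pos
  filter_upwards [hg.eventually_ratio_near hg0 hC hρ0, h3,
    eventually_ge_atTop (1 + max Y 1)] with x hx hx3 hxY y hy
  have hm := le_max_right Y 1
  have hm' := le_max_left Y 1
  have hyx := abs_le.1 (hy.trans hx3)
  have h4 := hY y (by linarith)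
  have h5 := hx y hy
  have hgx : 0 < g x := hg.pos x (by simp; linarith)
  have hgy : 0 < g y := hg.pos y (by simp; linarith)
  have hx0 : 0 < x := by linarith
  have hy0 : 0 < y := by linarith
  have hr0 : 0 < g x / x := by positivity
  have hry : 0 < g y / y := by positivity
  rw [Real.norm_eq_abs, Real.norm_eq_abs, abs_of_pos hry] at h4
  have hr2 : g y / y ≤ 2 * (g x / x) := by
    have := (abs_le.1 h5).2
    have : ρ * (g x / x) ≤ 1 * (g x / x) := by
      gcongr
      exact min_le_left _ _
    linarith
  have h6 : |γ| * ρ ≤ ε / 2 := by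
    have : ρ ≤ ε / (2 * (|γ| + 1)) := min_le_right _ _
    rw [le_div_iff₀ (by positivity)] at this
    nlinarith
  calc |der g 1 y - γ * (g x / x)|
      = |(der g 1 y - γ * (g y / y)) + γ * (g y / y - g x / x)| := by congr 1; ring
    _ ≤ |der g 1 y - γ * (g y / y)| + |γ| * |g y / y - g x / x| := by
        rw [← abs_mul]
        exact abs_add_le _ _
    _ ≤ ε / 4 * (2 * (g x / x)) + |γ| * (ρ * (g x / x)) := by
        gcongr
        exact h4.trans (by gcongr)
    _ = (ε / 2 + |γ| * ρ) * (g x / x) := by ring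
    _ ≤ _ := by
        gcongr
        linarith

variable {U X η : ℝ} {F : ℝ → ℝ → ℝ}

/-- The width at the landing point exceeds `g x` by at most `η` times the jump itself; since `η (U +
1) ≤ 1/4`, that term is absorbed on the left. -/
theorem IsLanding.abs_sub_le (hF : IsLanding g U X F) (h : Flat g U X η) (hg : RegularTube g γ)
    {x a : ℝ} (hx : 2 * X < x) (ha : |Real.tan a| ≤ U) :
    |F x a - x| ≤ 4 * (U + 1) * g x := by
  have hX := h.one_le
  have hFX := hF.lt X x a le_rfl hx ha
  have h1 := hF.eq x a hx ha
  have h2 := h.abs_horizontal_le (x := x) (by linarith) ha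
  have h3 := h.le_vertical (x := x) (by linarith) ha
  have h4 := hg.abs_sub_le hX h.abs_der_le (show X ≤ x by linarith) hFX.le
  have h5 := (abs_le.1 h4).2
  have h6 := h.slope_le
  have h7 := h.eta_nonneg
  have hgx : 0 < g x := hg.pos x (by simp; linarith)
  have hgF : 0 < g (F x a) := hg.pos _ (by simp; linarith)
  have hU := h.nonneg
  set D := |F x a - x| with hD
  have h8 : D * (1 - der g 1 x * Real.tan a) = (g x + g (F x a)) * |Real.tan a + der g 1 x| := by
    rw [hD, h1, abs_mul, abs_div, abs_of_pos (show 0 < g x + g (F x a) by positivity),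
      abs_of_pos (show 0 < 1 - der g 1 x * Real.tan a by linarith), mul_assoc,
      div_mul_cancel₀ _ (by linarith)]
  have hD0 : 0 ≤ D := abs_nonneg _
  have h9 : D * (3 / 4) ≤ (2 * g x + η * D) * (U + 1) :=
    calc D * (3 / 4) ≤ D * (1 - der g 1 x * Real.tan a) := by gcongr
      _ = (g x + g (F x a)) * |Real.tan a + der g 1 x| := h8
      _ ≤ _ := mul_le_mul (by linarith) h2 (abs_nonneg _) (by positivity)
  have h10 : η * D * (U + 1) ≤ 1 / 4 * D := by
    calc η * D * (U + 1) = (η * (U + 1)) * D := by ring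
      _ ≤ _ := by gcongr
  nlinarith

/-- The principal filter on the angles makes the error uniform in `a`, so that it can be integrated
against the law. -/
theorem IsLanding.rpow_isLittleO (hF : IsLanding g U X F) (h : Flat g U X η)
    (hg : RegularTube g γ) (hg0 : Tendsto g atTop (𝓝 0)) (p : ℝ) :
    (fun q : ℝ × ℝ => (F q.1 q.2 / q.1) ^ p - 1 - 2 * p * (g q.1 / q.1 * Real.tan q.2)
      - 2 * p * (g q.1 / q.1) ^ 2 * (γ * (1 + 2 * Real.tan q.2 ^ 2) + (p - 1) * Real.tan q.2 ^ 2))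
      =o[atTop ×ˢ 𝓟 {a | |Real.tan a| ≤ U}] fun q => (g q.1 / q.1) ^ 2 := by
  set l : Filter (ℝ × ℝ) := atTop ×ˢ 𝓟 {a | |Real.tan a| ≤ U} with hl
  have hX := h.one_le
  have hU := h.nonneg
  have hev : ∀ᶠ q : ℝ × ℝ in l, 2 * X < q.1 ∧ |Real.tan q.2| ≤ U := by
    rw [hl, eventually_prod_principal_iff]
    filter_upwards [eventually_gt_atTop (2 * X)] with x hx a ha using ⟨hx, ha⟩
  have hfst : Tendsto (fun q : ℝ × ℝ => q.1) l atTop := tendsto_fst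
  have hr := (tendsto_div_id_of_tendsto_zero hg0).comp hfst
  have hpos : ∀ x, 2 * X < x → 0 < g x ∧ 0 < x := fun x hx =>
    ⟨hg.pos x (by simp; linarith), by linarith⟩
  have key := rpow_displacement_isLittleO (l := l) (u := fun q => Real.tan q.2)
    (d := fun q => der g 1 q.1) (r := fun q => g q.1 / q.1)
    (δ := fun q => (F q.1 q.2 - q.1) / g q.1)
    (θ := fun q => (g (F q.1 q.2) - g q.1) / g q.1)
    (w := fun q => (Real.tan q.2 + der g 1 q.1) / (1 - der g 1 q.1 * Real.tan q.2))
    (γ := γ) p hr ?_ ?_ ?_ ?_ ?_ ?_ ?_ ?_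
  · refine key.congr' ?_ EventuallyEq.rfl
    filter_upwards [hev] with q hq
    obtain ⟨h1, h2⟩ := hpos q.1 hq.1
    have : 1 + g q.1 / q.1 * ((F q.1 q.2 - q.1) / g q.1) = F q.1 q.2 / q.1 := by
      field_simp
      ring
    rw [this]
  · refine Asymptotics.IsBigO.of_bound U ?_
    filter_upwards [hev] with q hq
    simpa using hq.2
  · refine Asymptotics.IsBigO.of_bound (4 * (U + 1)) ?_
    filter_upwards [hev] with q hq
    have h1 := (hpos q.1 hq.1).1
    rw [norm_div, Real.norm_eq_abs, Real.norm_eq_abs, abs_of_pos h1, div_le_iff₀ h1]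
    simpa using hF.abs_sub_le h hg hq.1 hq.2
  · exact hg.der_isLittleO.comp_tendsto hfst
  · rw [Asymptotics.isLittleO_iff]
    intro c hc
    have hC : 0 ≤ 4 * (U + 1) := by positivity
    have h1 := hg.eventually_der_near hg0 hC (show 0 < c / (4 * (U + 1)) by positivity)
    filter_upwards [hev, hfst.eventually h1] with q hq hq1
    obtain ⟨x, a⟩ := q
    simp only at hq hq1 ⊢
    obtain ⟨h2, h3⟩ := hpos x hq.1
    have h4 := hF.abs_sub_le h hg hq.1 hq.2
    have hFX := hF.lt X x a le_rfl hq.1 hq.2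
    have hsub : ∀ y ∈ uIcc x (F x a), 1 < y ∧ |y - x| ≤ 4 * (U + 1) * g x := by
      intro y hy
      refine ⟨?_, (abs_sub_left_of_mem_uIcc hy).trans h4⟩
      have := (mem_uIcc.1 hy)
      rcases this with h5 | h5 <;> linarith [h5.1]
    -- Mean value inequality for `g` minus its approximate linear part, giving `θ = γ r δ + o(r)`.
    have h5 := Convex.norm_image_sub_le_of_norm_hasDerivWithin_le
      (f := fun y => g y - γ * (g x / x) * y) (f' := fun y => der g 1 y - γ * (g x / x))
      (s := uIcc x (F x a)) (C := c / (4 * (U + 1)) * (g x / x))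
      (fun y hy => by
        have := (hg.hasDerivAt (hsub y hy).1).sub ((hasDerivAt_id y).const_mul (γ * (g x / x)))
        rw [mul_one] at this
        exact this.hasDerivWithinAt)
      (fun y hy => hq1 y (hsub y hy).2) (convex_uIcc _ _) left_mem_uIcc right_mem_uIcc
    simp only [Real.norm_eq_abs] at h5 ⊢
    rw [abs_of_pos (show 0 < g x / x by positivity)]
    have h6 : (g (F x a) - g x) / g x - γ * (g x / x) * ((F x a - x) / g x)
        = (g (F x a) - γ * (g x / x) * F x a - (g x - γ * (g x / x) * x)) / g x := by ring
    rw [h6, abs_div, abs_of_pos h2, div_le_iff₀ h2]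
    calc _ ≤ c / (4 * (U + 1)) * (g x / x) * |F x a - x| := h5
      _ ≤ c / (4 * (U + 1)) * (g x / x) * (4 * (U + 1) * g x) := by gcongr
      _ = _ := by field_simp
  · refine Asymptotics.IsBigO.of_bound (4 / 3) ?_
    filter_upwards [hev] with q hq
    have h1 := h.le_vertical (x := q.1) (by linarith [hq.1]) hq.2
    rw [norm_inv, Real.norm_eq_abs, abs_of_pos (by linarith), norm_one, mul_one,
      inv_le_comm₀ (by linarith) (by norm_num)]
    linarith
  · filter_upwards [hev] with q hq
    have h1 := h.le_vertical (x := q.1) (by linarith [hq.1]) hq.2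
    linarith
  · exact Eventually.of_forall fun _ => rfl
  · filter_upwards [hev] with q hq
    have h1 := (hpos q.1 hq.1).1
    rw [hF.eq q.1 q.2 hq.1 hq.2]
    field_simp
    ring

end Tube

/-! ### Drift of powers of the abscissa -/

section Drift

variable {g : ℝ → ℝ} {γ U X η : ℝ} {F : ℝ → ℝ → ℝ} {μ : Measure ℝ}

theorem IsReflectionLaw.map_neg [IsFiniteMeasure μ] (hμ : IsReflectionLaw μ) :
    μ.map (fun x => -x) = μ := by
  refine Measure.ext_of_Ici _ _ fun x => ?_
  rw [Measure.map_apply measurable_neg measurableSet_Ici, hμ.2 x]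
  congr 1
  ext y
  simp

theorem IsReflectionLaw.integral_tan [IsFiniteMeasure μ] (hμ : IsReflectionLaw μ) :
    ∫ a, Real.tan a ∂μ = 0 := by
  have h : ∫ a, Real.tan a ∂μ = ∫ a, Real.tan (-a) ∂μ := by
    conv_lhs => rw [← hμ.map_neg]
    exact integral_map measurable_neg.aemeasurable measurable_tan.aestronglyMeasurable
  simp only [Real.tan_neg, integral_neg] at h
  linarith

theorem IsReflectionLaw.exists_bound (hμ : IsReflectionLaw μ) :
    ∃ U, 0 ≤ U ∧ ∀ᵐ a ∂μ, |Real.tan a| ≤ U ∧ 0 < Real.cos a := by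
  obtain ⟨α₀, h0, h⟩ := hμ.1
  refine ⟨Real.tan α₀, Real.tan_nonneg_of_nonneg_of_le_pi_div_two h0.1.le h0.2.le, ?_⟩
  filter_upwards [h] with a ha
  obtain ⟨h1, h2⟩ := abs_lt.1 ha
  refine ⟨abs_le.2 ⟨?_, ?_⟩, Real.cos_pos_of_mem_Ioo ⟨by linarith [h0.2], by linarith [h0.2]⟩⟩
  · rw [← Real.tan_neg]
    exact (Real.tan_lt_tan_of_lt_of_lt_pi_div_two (by linarith [h0.2]) (by linarith [h0.2]) h1).le
  · exact (Real.tan_lt_tan_of_lt_of_lt_pi_div_two (by linarith [h0.2]) h0.2 h2).le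

/-- Normalised drift of the `p`-th power of the abscissa, where `v` is the mean of `tan² α`. -/
def driftCoeff (γ v p : ℝ) : ℝ := 2 * p * (γ * (1 + 2 * v) + (p - 1) * v)

theorem IsLanding.eventually_abs_drift_le [IsProbabilityMeasure μ] (hμ : IsReflectionLaw μ)
    (hU : ∀ᵐ a ∂μ, |Real.tan a| ≤ U)
    (hF : IsLanding g U X F) (h : Flat g U X η) (hg : RegularTube g γ)
    (hg0 : Tendsto g atTop (𝓝 0)) (p : ℝ) {ε : ℝ} (hε : 0 < ε) :
    ∀ᶠ x in atTop, Integrable (fun a => F x a ^ p) μ ∧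
      |∫ a, F x a ^ p ∂μ
        - x ^ p * (1 + driftCoeff γ (∫ a, Real.tan a ^ 2 ∂μ) p * (g x / x) ^ 2)|
        ≤ ε * (x ^ p * (g x / x) ^ 2) := by
  have h1 := (hF.rpow_isLittleO h hg hg0 p).def hε
  rw [eventually_prod_principal_iff] at h1
  filter_upwards [h1, eventually_gt_atTop (2 * X)] with x hx hxX
  have hX := h.one_le
  have hx0 : 0 < x := by linarith
  set r := g x / x
  set E : ℝ → ℝ := fun a => (F x a / x) ^ p - 1 - 2 * p * (r * Real.tan a)
      - 2 * p * r ^ 2 * (γ * (1 + 2 * Real.tan a ^ 2) + (p - 1) * Real.tan a ^ 2) with hE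
  have hEb : ∀ᵐ a ∂μ, ‖E a‖ ≤ ε * r ^ 2 := by
    filter_upwards [hU] with a ha
    have := hx a ha
    rwa [norm_pow, Real.norm_eq_abs r, sq_abs] at this
  have hFm : Measurable fun a => F x a := hF.measurable.comp measurable_prodMk_left
  have hEm : Measurable E := by
    have := measurable_tan
    fun_prop
  have hEi : Integrable E μ := Integrable.of_bound hEm.aestronglyMeasurable _ hEb
  have ht1 : Integrable (fun a => Real.tan a) μ :=
    Integrable.of_bound measurable_tan.aestronglyMeasurable U hU
  have ht2 : Integrable (fun a => Real.tan a ^ 2) μ := by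
    refine Integrable.of_bound (measurable_tan.pow_const 2).aestronglyMeasurable (U ^ 2) ?_
    filter_upwards [hU] with a ha
    rw [norm_pow]
    exact pow_le_pow_left₀ (norm_nonneg _) ha 2
  have hpt : ∀ᵐ a ∂μ, F x a ^ p = x ^ p * (E a + ((1 + 2 * p * r ^ 2 * γ) + 2 * p * r * Real.tan a
      + (2 * p * r ^ 2 * (2 * γ + (p - 1))) * Real.tan a ^ 2)) := by
    filter_upwards [hU] with a ha
    have hFX := hF.lt X x a le_rfl hxX ha
    have : F x a ^ p = x ^ p * (F x a / x) ^ p := by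
      rw [Real.div_rpow (by linarith) hx0.le, mul_div_cancel₀ _ (Real.rpow_pos_of_pos hx0 p).ne']
    rw [this, hE]
    ring
  have hi1 : Integrable (fun a => (1 + 2 * p * r ^ 2 * γ) + 2 * p * r * Real.tan a) μ :=
    (integrable_const _).add (ht1.const_mul _)
  have hi2 : Integrable (fun a => (1 + 2 * p * r ^ 2 * γ) + 2 * p * r * Real.tan a
      + (2 * p * r ^ 2 * (2 * γ + (p - 1))) * Real.tan a ^ 2) μ := hi1.add (ht2.const_mul _)
  refine ⟨((hEi.add hi2).const_mul (x ^ p)).congr (hpt.mono fun a ha => by simp [ha]), ?_⟩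
  rw [integral_congr_ae hpt, integral_const_mul, integral_add hEi hi2,
    integral_add hi1 (ht2.const_mul _), integral_add (integrable_const _) (ht1.const_mul _),
    integral_const_mul, integral_const_mul, hμ.integral_tan, integral_const]
  have hEint : |∫ a, E a ∂μ| ≤ ε * r ^ 2 := by
    have := norm_integral_le_of_norm_le_const hEb
    simpa using this
  have hxp := Real.rpow_pos_of_pos hx0 p
  have : x ^ p * (∫ a, E a ∂μ + (μ.real univ • (1 + 2 * p * r ^ 2 * γ) + 2 * p * r * 0
      + 2 * p * r ^ 2 * (2 * γ + (p - 1)) * ∫ a, Real.tan a ^ 2 ∂μ))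
      - x ^ p * (1 + driftCoeff γ (∫ a, Real.tan a ^ 2 ∂μ) p * r ^ 2)
      = x ^ p * ∫ a, E a ∂μ := by
    simp only [driftCoeff, probReal_univ, smul_eq_mul]
    ring
  rw [this, abs_mul, abs_of_pos hxp]
  calc x ^ p * |∫ a, E a ∂μ| ≤ x ^ p * (ε * r ^ 2) := by gcongr
    _ = _ := by ring

/-- This identity singles out the critical exponent `2 - 2γ`, above which the drift scale diverges
and below which it vanishes. -/
theorem rpow_mul_width_sq {x q γ e : ℝ} (hx : 0 < x) (hgx : g x = x ^ (γ + e)) :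
    x ^ q * (g x / x) ^ 2 = x ^ (q - 2 + 2 * γ + 2 * e) := by
  rw [hgx, div_pow, ← Real.rpow_natCast (x ^ (γ + e)), ← Real.rpow_natCast x, ← Real.rpow_mul hx.le,
    ← Real.rpow_sub hx, ← Real.rpow_add hx]
  congr 1
  push_cast
  ring

theorem RegularTube.tendsto_rpow_mul_atTop (hg : RegularTube g γ) {q : ℝ} (hq : 2 - 2 * γ < q) :
    Tendsto (fun x => x ^ q * (g x / x) ^ 2) atTop atTop := by
  obtain ⟨e, he, h⟩ := hg.growth
  set s := (q - 2 + 2 * γ) / 2 with hs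
  have hs0 : 0 < s := by rw [hs]; linarith
  refine tendsto_atTop_mono' _ ?_ (tendsto_rpow_atTop hs0)
  filter_upwards [h, he.eventually_const_le (show -(s / 2) < 0 by linarith),
    eventually_ge_atTop 1] with x hx hex hx1
  rw [rpow_mul_width_sq (by linarith) hx]
  exact Real.rpow_le_rpow_of_exponent_le hx1 (by linarith)

theorem RegularTube.tendsto_rpow_mul_zero (hg : RegularTube g γ) {q : ℝ} (hq : q < 2 - 2 * γ) :
    Tendsto (fun x => x ^ q * (g x / x) ^ 2) atTop (𝓝 0) := by
  obtain ⟨e, he, h⟩ := hg.growth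
  set s := (2 - 2 * γ - q) / 2 with hs
  have hs0 : 0 < s := by rw [hs]; linarith
  refine squeeze_zero' ?_ ?_ (tendsto_rpow_neg_atTop hs0)
  · filter_upwards [eventually_ge_atTop 0] with x hx
    have := Real.rpow_nonneg hx q
    positivity
  · filter_upwards [h, he.eventually_le_const (show 0 < s / 2 by linarith),
      eventually_ge_atTop 1] with x hx hex hx1
    rw [rpow_mul_width_sq (by linarith) hx]
    exact Real.rpow_le_rpow_of_exponent_le hx1 (by linarith)

end Drift

/-! ### Lyapunov criteria for the stopped chain -/

section StoppedChain

/-- The chain `x ↦ F x a`, started at `x₀` and stopped once it is at most `B`. -/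
noncomputable def stoppedChain (F : ℝ → ℝ → ℝ) (B x₀ : ℝ) (a : ℕ → ℝ) : ℕ → ℝ
  | 0 => x₀
  | n + 1 => if B < stoppedChain F B x₀ a n then F (stoppedChain F B x₀ a n) (a n)
      else stoppedChain F B x₀ a n

/-- One step of the stopped chain. -/
noncomputable def stoppedStep (F : ℝ → ℝ → ℝ) (B z a : ℝ) : ℝ := if B < z then F z a else z

variable {F : ℝ → ℝ → ℝ} {B x₀ : ℝ}

theorem measurable_stoppedStep (hF : Measurable (Function.uncurry F)) :
    Measurable (Function.uncurry (stoppedStep F B)) :=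
  Measurable.ite (measurableSet_lt measurable_const measurable_fst) hF measurable_fst

theorem stoppedChain_succ (a : ℕ → ℝ) (n : ℕ) :
    stoppedChain F B x₀ a (n + 1) = stoppedStep F B (stoppedChain F B x₀ a n) (a n) := rfl

theorem exists_measurable_stoppedChain (hF : Measurable (Function.uncurry F)) (n : ℕ) :
    ∃ ψ : (Finset.range n → ℝ) → ℝ, Measurable ψ ∧
      ∀ a : ℕ → ℝ, stoppedChain F B x₀ a n = ψ fun i => a i := by
  induction n with
  | zero => exact ⟨fun _ => x₀, measurable_const, fun a => rfl⟩
  | succ n ih =>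
    obtain ⟨ψ, hψ, h⟩ := ih
    refine ⟨fun b => stoppedStep F B
      (ψ fun i => b ⟨i, Finset.mem_range.2 ((Finset.mem_range.1 i.2).trans n.lt_succ_self)⟩)
      (b ⟨n, Finset.self_mem_range_succ n⟩), ?_, fun a => by rw [stoppedChain_succ, h]⟩
    have h1 : Measurable fun b : Finset.range (n + 1) → ℝ =>
        ψ fun i : Finset.range n =>
          b ⟨i, Finset.mem_range.2 ((Finset.mem_range.1 i.2).trans n.lt_succ_self)⟩ :=
      hψ.comp (measurable_pi_lambda _ fun i => measurable_pi_apply _)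
    exact (measurable_stoppedStep hF).comp (h1.prodMk (measurable_pi_apply _))

variable {Ω : Type*} [MeasurableSpace Ω] {P : Measure Ω} {μ : Measure ℝ} {α : ℕ → Ω → ℝ}

theorem measurable_stoppedChain (hF : Measurable (Function.uncurry F))
    (hα : ∀ n, Measurable (α n)) (n : ℕ) :
    Measurable fun ω => stoppedChain F B x₀ (fun k => α k ω) n := by
  obtain ⟨ψ, hψ, h⟩ := exists_measurable_stoppedChain (B := B) (x₀ := x₀) hF n
  simp only [h]
  exact hψ.comp (measurable_pi_lambda _ fun i => hα i)

variable [IsProbabilityMeasure P] [IsProbabilityMeasure μ]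

/-- The Markov property: the state at time `n` depends only on the angles of index below `n`, hence
is independent of `α n`. -/
theorem lintegral_stoppedChain_succ (hF : Measurable (Function.uncurry F))
    (hα : ∀ n, Measurable (α n)) (hlaw : ∀ n, P.map (α n) = μ) (hind : iIndepFun α P)
    {φ : ℝ → ℝ≥0∞} (hφ : Measurable φ) (n : ℕ) :
    ∫⁻ ω, φ (stoppedChain F B x₀ (fun k => α k ω) (n + 1)) ∂P =
      ∫⁻ ω, ∫⁻ a, φ (stoppedStep F B (stoppedChain F B x₀ (fun k => α k ω) n) a) ∂μ ∂P := by
  have hZ := measurable_stoppedChain (B := B) (x₀ := x₀) hF hα n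
  have hI : IndepFun (fun ω => stoppedChain F B x₀ (fun k => α k ω) n) (α n) P := by
    obtain ⟨ψ, hψ, h⟩ := exists_measurable_stoppedChain (B := B) (x₀ := x₀) hF n
    have h1 := hind.indepFun_finset (Finset.range n) {n} (by simp) hα
    have h2 := h1.comp hψ (measurable_pi_apply (⟨n, Finset.mem_singleton_self n⟩ : ({n} : Finset ℕ)))
    simp only [h]
    exact h2
  have hm := (indepFun_iff_map_prod_eq_prod_map_map hZ.aemeasurable (hα n).aemeasurable).1 hI
  have hG : Measurable fun q : ℝ × ℝ => φ (stoppedStep F B q.1 q.2) :=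
    hφ.comp (measurable_stoppedStep hF)
  calc ∫⁻ ω, φ (stoppedChain F B x₀ (fun k => α k ω) (n + 1)) ∂P
      = ∫⁻ q, φ (stoppedStep F B q.1 q.2)
          ∂(P.map fun ω => (stoppedChain F B x₀ (fun k => α k ω) n, α n ω)) := by
        rw [lintegral_map hG (hZ.prodMk (hα n))]
        rfl
    _ = _ := by
        rw [hm, hlaw, lintegral_prod _ hG.aemeasurable, lintegral_map hG.lintegral_prod_right' hZ]

/-- Telescoped supermartingale inequality; the stopped part of the chain contributes no drift. -/
theorem lintegral_add_sum_le (hF : Measurable (Function.uncurry F))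
    (hα : ∀ n, Measurable (α n)) (hlaw : ∀ n, P.map (α n) = μ) (hind : iIndepFun α P)
    {φ e : ℝ → ℝ≥0∞} (hφ : Measurable φ) (he : Measurable e)
    (h : ∀ z, B < z → ∫⁻ a, φ (F z a) ∂μ + e z ≤ φ z) (N : ℕ) :
    ∫⁻ ω, φ (stoppedChain F B x₀ (fun k => α k ω) N) ∂P + ∑ n ∈ Finset.range N,
      ∫⁻ ω, (Ioi B).indicator e (stoppedChain F B x₀ (fun k => α k ω) n) ∂P ≤ φ x₀ := by
  induction N with
  | zero => simp [stoppedChain]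
  | succ n ih =>
    refine le_trans ?_ ih
    rw [Finset.sum_range_succ_comm, ← add_assoc, lintegral_stoppedChain_succ hF hα hlaw hind hφ]
    gcongr
    have hZ := measurable_stoppedChain (B := B) (x₀ := x₀) hF hα n
    have hm : Measurable fun ω => (Ioi B).indicator e (stoppedChain F B x₀ (fun k => α k ω) n) :=
      (he.indicator measurableSet_Ioi).comp hZ
    rw [← lintegral_add_right _ hm]
    refine lintegral_mono fun ω => ?_
    by_cases hz : B < stoppedChain F B x₀ (fun k => α k ω) n
    · simpa [stoppedStep, hz] using h _ hz
    · simp [stoppedStep, hz]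

theorem le_lintegral_add_sum (hF : Measurable (Function.uncurry F))
    (hα : ∀ n, Measurable (α n)) (hlaw : ∀ n, P.map (α n) = μ) (hind : iIndepFun α P)
    {φ : ℝ → ℝ≥0∞} (hφ : Measurable φ)
    (h : ∀ z, B < z → φ z ≤ ∫⁻ a, φ (F z a) ∂μ + 1) (N : ℕ) :
    φ x₀ ≤ ∫⁻ ω, φ (stoppedChain F B x₀ (fun k => α k ω) N) ∂P + ∑ n ∈ Finset.range N,
      P {ω | B < stoppedChain F B x₀ (fun k => α k ω) n} := by
  induction N with
  | zero => simp [stoppedChain]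
  | succ n ih =>
    refine ih.trans ?_
    rw [Finset.sum_range_succ_comm, ← add_assoc, lintegral_stoppedChain_succ hF hα hlaw hind hφ]
    gcongr
    have hZ := measurable_stoppedChain (B := B) (x₀ := x₀) hF hα n
    have hm : MeasurableSet {ω | B < stoppedChain F B x₀ (fun k => α k ω) n} :=
      measurableSet_lt measurable_const hZ
    rw [← lintegral_indicator_one hm, ← lintegral_add_right _ (measurable_one.indicator hm)]
    refine lintegral_mono fun ω => ?_
    by_cases hz : B < stoppedChain F B x₀ (fun k => α k ω) n
    · simpa [stoppedStep, hz] using h _ hz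
    · simp [stoppedStep, hz]

/-- Foster's criterion. -/
theorem tsum_measure_le (hF : Measurable (Function.uncurry F))
    (hα : ∀ n, Measurable (α n)) (hlaw : ∀ n, P.map (α n) = μ) (hind : iIndepFun α P)
    {φ : ℝ → ℝ≥0∞} (hφ : Measurable φ) (h : ∀ z, B < z → ∫⁻ a, φ (F z a) ∂μ + 1 ≤ φ z) :
    ∑' n, P {ω | B < stoppedChain F B x₀ (fun k => α k ω) n} ≤ φ x₀ := by
  refine ENNReal.tsum_le_of_sum_range_le fun N => ?_
  refine le_trans ?_ (lintegral_add_sum_le (x₀ := x₀) (e := 1) hF hα hlaw hind hφ measurable_one h N)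
  refine le_add_left (Finset.sum_le_sum fun n _ => ?_)
  have hm : MeasurableSet {ω | B < stoppedChain F B x₀ (fun k => α k ω) n} :=
    measurableSet_lt measurable_const (measurable_stoppedChain hF hα n)
  rw [← lintegral_indicator_one hm]
  exact le_of_eq rfl

/-- A function that tends to infinity and has negative drift makes the chain reach `(-∞, B]`. -/
theorem tendsto_measure_zero (hF : Measurable (Function.uncurry F))
    (hα : ∀ n, Measurable (α n)) (hlaw : ∀ n, P.map (α n) = μ) (hind : iIndepFun α P)
    {φ e : ℝ → ℝ≥0∞} (hφ : Measurable φ) (he : Measurable e)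
    (h : ∀ z, B < z → ∫⁻ a, φ (F z a) ∂μ + e z ≤ φ z) (hx₀ : φ x₀ ≠ ∞)
    (hlim : ∀ M : ℝ≥0∞, M ≠ ∞ → ∃ K, ∀ z, K < z → M ≤ φ z)
    (hpos : ∀ K, ∃ c : ℝ≥0∞, c ≠ 0 ∧ c ≠ ∞ ∧ ∀ z, B < z → z ≤ K → c ≤ e z) :
    Tendsto (fun n => P {ω | B < stoppedChain F B x₀ (fun k => α k ω) n}) atTop (𝓝 0) := by
  have hsup := lintegral_add_sum_le (x₀ := x₀) hF hα hlaw hind hφ he h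
  set Z : ℕ → Ω → ℝ := fun n ω => stoppedChain F B x₀ (fun k => α k ω) n with hZdef
  have hZ : ∀ n, Measurable (Z n) := fun n => measurable_stoppedChain hF hα n
  have hsum : ∑' n, ∫⁻ ω, (Ioi B).indicator e (Z n ω) ∂P ≠ ∞ := by
    refine ne_top_of_le_ne_top hx₀ (ENNReal.tsum_le_of_sum_range_le fun N => ?_)
    exact (le_add_left le_rfl).trans (hsup N)
  have ht := ENNReal.tendsto_atTop_zero_of_tsum_ne_top hsum
  rw [ENNReal.tendsto_atTop_zero]
  intro ε hε
  by_cases hεt : ε = ∞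
  · exact ⟨0, fun n _ => hεt ▸ le_top⟩
  have hε2 : ε / 2 ≠ 0 := (ENNReal.half_pos hε.ne').ne'
  have hε2t : ε / 2 ≠ ∞ := ENNReal.div_ne_top hεt (by norm_num)
  -- The level comes from Markov's inequality with mean at most `φ x₀`; the extra `1` makes it
  -- nonzero, so it can be cancelled.
  have hM0 : (φ x₀ + 1) / (ε / 2) ≠ 0 := ENNReal.div_ne_zero.2 ⟨by simp, hε2t⟩
  have hMt : (φ x₀ + 1) / (ε / 2) ≠ ∞ := ENNReal.div_ne_top (by simpa using hx₀) hε2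
  obtain ⟨K, hK⟩ := hlim _ hMt
  obtain ⟨c, hc0, hct, hc⟩ := hpos K
  obtain ⟨N, hN⟩ := ENNReal.tendsto_atTop_zero.1 ht (c * (ε / 2))
    (pos_iff_ne_zero.2 (mul_ne_zero hc0 hε2))
  refine ⟨N, fun n hn => ?_⟩
  have h1 : P {ω | c ≤ (Ioi B).indicator e (Z n ω)} ≤ ε / 2 := by
    have hm : Measurable fun ω => (Ioi B).indicator e (Z n ω) :=
      (he.indicator measurableSet_Ioi).comp (hZ n)
    have h2 : c * P {ω | c ≤ (Ioi B).indicator e (Z n ω)} ≤ c * (ε / 2) :=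
      (mul_meas_ge_le_lintegral₀ hm.aemeasurable c).trans (hN n hn)
    exact (ENNReal.mul_le_mul_iff_right hc0 hct).1 h2
  have h2 : P {ω | K < Z n ω} ≤ ε / 2 := by
    have hm : Measurable fun ω => φ (Z n ω) := hφ.comp (hZ n)
    have h3 := mul_meas_ge_le_lintegral₀ (μ := P) hm.aemeasurable ((φ x₀ + 1) / (ε / 2))
    have h4 : (φ x₀ + 1) / (ε / 2) * P {ω | K < Z n ω} ≤ (φ x₀ + 1) / (ε / 2) * (ε / 2) := by
      rw [ENNReal.div_mul_cancel hε2 hε2t]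
      refine le_trans ?_ ((h3.trans ((le_add_right le_rfl).trans (hsup n))).trans le_self_add)
      gcongr with ω
      exact fun hω => hK _ hω
    exact (ENNReal.mul_le_mul_iff_right hM0 hMt).1 h4
  -- Either the chain is above `K`, unlikely since `φ` is large there, or it lies in `(B, K]`, where
  -- `e ≥ c`, unlikely since the means of `e` are summable.
  calc P {ω | B < Z n ω} ≤ P ({ω | c ≤ (Ioi B).indicator e (Z n ω)} ∪ {ω | K < Z n ω}) := by
        refine measure_mono fun ω hω => ?_
        rcases lt_or_ge K (Z n ω) with h3 | h3
        · exact Or.inr h3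
        · refine Or.inl ?_
          have hω' : Z n ω ∈ Ioi B := hω
          simpa [indicator_of_mem hω'] using hc _ hω h3
    _ ≤ ε / 2 + ε / 2 := (measure_union_le _ _).trans (add_le_add h1 h2)
    _ = ε := ENNReal.add_halves ε

/-- Boundedness of `φ` is essential: it bounds the terminal term by `C` times the survival
probability, which tends to zero. -/
theorem le_tsum_measure (hF : Measurable (Function.uncurry F))
    (hα : ∀ n, Measurable (α n)) (hlaw : ∀ n, P.map (α n) = μ) (hind : iIndepFun α P)
    {φ : ℝ → ℝ≥0∞} (hφ : Measurable φ) (h : ∀ z, B < z → φ z ≤ ∫⁻ a, φ (F z a) ∂μ + 1)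
    (hzero : ∀ z, z ≤ B → φ z = 0) {C : ℝ≥0∞} (hC : C ≠ ∞) (hbd : ∀ z, φ z ≤ C)
    (hrec : Tendsto (fun n => P {ω | B < stoppedChain F B x₀ (fun k => α k ω) n}) atTop (𝓝 0)) :
    φ x₀ ≤ ∑' n, P {ω | B < stoppedChain F B x₀ (fun k => α k ω) n} := by
  have h1 : ∀ N, φ x₀ ≤ C * P {ω | B < stoppedChain F B x₀ (fun k => α k ω) N}
      + ∑' n, P {ω | B < stoppedChain F B x₀ (fun k => α k ω) n} := by
    intro N
    refine (le_lintegral_add_sum hF hα hlaw hind hφ h N).trans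
      (add_le_add ?_ (ENNReal.sum_le_tsum _))
    have hm : MeasurableSet {ω | B < stoppedChain F B x₀ (fun k => α k ω) N} :=
      measurableSet_lt measurable_const (measurable_stoppedChain hF hα N)
    rw [← lintegral_indicator_const hm]
    refine lintegral_mono fun ω => ?_
    by_cases hz : B < stoppedChain F B x₀ (fun k => α k ω) N
    · simpa [indicator, hz] using hbd _
    · simp [indicator, hz, hzero _ (not_lt.1 hz)]
  have h2 := (ENNReal.Tendsto.const_mul hrec (Or.inr hC)).add_const
    (∑' n, P {ω | B < stoppedChain F B x₀ (fun k => α k ω) n})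
  rw [mul_zero, zero_add] at h2
  exact ge_of_tendsto' h2 h1

end StoppedChain

/-! ### From the collisions process to the stopped chain -/

section ReturnTime

variable {g : ℝ → ℝ} {γ U X A : ℝ} {F : ℝ → ℝ → ℝ}

theorem returnTime_le_iff {ξ : ℕ → Option (ℝ × ℝ)} {n : ℕ} :
    returnTime A ξ ≤ n ↔ ∃ k ≤ n, ∃ p, ξ k = some p ∧ p.1 ≤ 2 * A := by
  constructor
  · intro h
    set S := {m : ℕ∞ | ∃ n : ℕ, m = n ∧ ∃ p, ξ n = some p ∧ p.1 ≤ 2 * A} with hS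
    have hne : S.Nonempty := by
      by_contra hemp
      rw [not_nonempty_iff_eq_empty] at hemp
      have : returnTime A ξ = sInf S := rfl
      rw [this, hemp, sInf_empty] at h
      exact absurd h (by simp)
    obtain ⟨k, hk, p, hp⟩ := csInf_mem hne
    have h' : sInf S ≤ n := h
    rw [hk] at h'
    exact ⟨k, by exact_mod_cast h', p, hp⟩
  · rintro ⟨k, hk, p, hp⟩
    have hmem : (k : ℕ∞) ∈ {m : ℕ∞ | ∃ n : ℕ, m = n ∧ ∃ p, ξ n = some p ∧ p.1 ≤ 2 * A} :=
      ⟨k, rfl, p, hp⟩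
    exact (sInf_le hmem).trans (by exact_mod_cast hk)

theorem IsLanding.lt_returnTime_iff (hF : IsLanding g U X F) (hA : X ≤ A) {p₀ : ℝ × ℝ}
    (hp₀ : |p₀.2| = g p₀.1) {a : ℕ → ℝ} (ha : ∀ n, |Real.tan (a n)| ≤ U ∧ 0 < Real.cos (a n))
    (n : ℕ) : (n : ℕ∞) < returnTime A (collisions g A p₀ a) ↔
      2 * A < stoppedChain F (2 * A) p₀.1 a n := by
  -- After the return the collisions continue while the chain is frozen, so the second half of the
  -- invariant only records an earlier visit.
  have key : ∀ n, (2 * A < stoppedChain F (2 * A) p₀.1 a n →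
        (∃ q, collisions g A p₀ a n = some q ∧ q.1 = stoppedChain F (2 * A) p₀.1 a n ∧
          |q.2| = g q.1) ∧ ∀ k ≤ n, ∀ p, collisions g A p₀ a k = some p → 2 * A < p.1) ∧
      (stoppedChain F (2 * A) p₀.1 a n ≤ 2 * A →
        ∃ k ≤ n, ∃ p, collisions g A p₀ a k = some p ∧ p.1 ≤ 2 * A) := by
    intro n
    induction n with
    | zero =>
      refine ⟨fun h => ⟨⟨p₀, rfl, rfl, hp₀⟩, ?_⟩, fun h => ⟨0, le_rfl, p₀, rfl, h⟩⟩
      intro k hk p hp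
      obtain rfl := Nat.le_zero.1 hk
      obtain rfl := Option.some.inj hp
      exact h
    | succ n ih =>
      rw [stoppedChain_succ, stoppedStep]
      split_ifs with hn
      · obtain ⟨⟨q, hq, hq1, hq2⟩, hk⟩ := ih.1 hn
        obtain ⟨q', hs, hs1, hs2⟩ := hF.step A _ (a n) hA hn (ha n).1 (ha n).2 q hq1
          (by rw [hq2, hq1])
        have hc : collisions g A p₀ a (n + 1) = some q' := by rw [collisions, hq, hs]
        refine ⟨fun h => ⟨⟨q', hc, hs1, hs2⟩, ?_⟩, fun h => ⟨n + 1, le_rfl, q', hc, hs1 ▸ h⟩⟩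
        intro k hkn p hp
        rcases Nat.le_succ_iff.1 hkn with h1 | rfl
        · exact hk k h1 p hp
        · rw [hc] at hp
          obtain rfl := Option.some.inj hp
          rwa [hs1]
      · refine ⟨fun h => absurd h hn, fun _ => ?_⟩
        obtain ⟨k, hk, h⟩ := ih.2 (not_lt.1 hn)
        exact ⟨k, hk.trans n.le_succ, h⟩
  rw [← not_le, returnTime_le_iff, ← not_iff_not, not_not, not_lt]
  refine ⟨fun ⟨k, hk, p, hp, hpA⟩ => ?_, (key n).2⟩
  by_contra! h
  exact absurd (((key n).1 h).2 k hk p hp) (not_lt.2 hpA)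

theorem toENNReal_eq_tsum (τ : ℕ∞) :
    (τ : ℝ≥0∞) = ∑' n : ℕ, {n : ℕ | (n : ℕ∞) < τ}.indicator (fun _ => (1 : ℝ≥0∞)) n := by
  rw [← tsum_subtype, ENNReal.tsum_set_const, mul_one]
  congr 1
  cases τ with
  | top => simp
  | coe m =>
    have : {n : ℕ | (n : ℕ∞) < m} = Iio m := by ext; simp
    rw [this]
    simp [Set.encard_eq_coe_toFinset_card]

variable {Ω : Type*} [MeasurableSpace Ω] {P : Measure Ω} {μ : Measure ℝ} {α : ℕ → Ω → ℝ}

/-- The angles are only almost everywhere measurable; `β` stands for measurable versions of them. -/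
theorem IsLanding.ae_lt_returnTime_iff (hF : IsLanding g U X F) (hA : X ≤ A) {p₀ : ℝ × ℝ}
    (hp₀ : |p₀.2| = g p₀.1) (hU : ∀ᵐ a ∂μ, |Real.tan a| ≤ U ∧ 0 < Real.cos a)
    (hlaw : ∀ n, HasLaw (α n) μ P) {β : ℕ → Ω → ℝ} (hβ : ∀ n, α n =ᵐ[P] β n) :
    ∀ᵐ ω ∂P, ∀ n : ℕ, (n : ℕ∞) < returnTime A (collisions g A p₀ fun k => α k ω) ↔
      2 * A < stoppedChain F (2 * A) p₀.1 (fun k => β k ω) n := by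
  have h1 : ∀ᵐ ω ∂P, ∀ n, |Real.tan (α n ω)| ≤ U ∧ 0 < Real.cos (α n ω) := by
    refine ae_all_iff.2 fun n => ?_
    have := hU
    rw [← (hlaw n).map_eq] at this
    exact ae_of_ae_map (hlaw n).aemeasurable this
  filter_upwards [h1, ae_all_iff.2 hβ] with ω hω hωβ n
  simp only [← hωβ]
  exact hF.lt_returnTime_iff hA hp₀ hω n

theorem recurrent_of_tendsto [IsProbabilityMeasure P] {ξ : Ω → ℕ → Option (ℝ × ℝ)}
    {Z : ℕ → Ω → ℝ} {B : ℝ} (h : ∀ᵐ ω ∂P, ∀ n : ℕ, (n : ℕ∞) < returnTime A (ξ ω) ↔ B < Z n ω)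
    (hZ : Tendsto (fun n => P {ω | B < Z n ω}) atTop (𝓝 0)) : Recurrent P A ξ := by
  have h0 : P {ω | ∀ n, B < Z n ω} = 0 :=
    le_antisymm (ge_of_tendsto' hZ fun n => measure_mono fun ω hω => hω n) zero_le
  have hae : ∀ᵐ ω ∂P, returnTime A (ξ ω) < ⊤ := by
    have h1 : ∀ᵐ ω ∂P, ¬ ∀ n, B < Z n ω := by
      rw [ae_iff]
      simpa using h0
    filter_upwards [h, h1] with ω hω hω1
    by_contra htop
    rw [not_lt_top_iff] at htop
    exact hω1 fun n => (hω n).1 (htop ▸ ENat.natCast_lt_top n)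
  rw [Recurrent, measure_congr (eventuallyEq_univ.2 hae), measure_univ]

theorem lintegral_returnTime {ξ : Ω → ℕ → Option (ℝ × ℝ)} {Z : ℕ → Ω → ℝ} {B : ℝ}
    (hZm : ∀ n, Measurable (Z n))
    (h : ∀ᵐ ω ∂P, ∀ n : ℕ, (n : ℕ∞) < returnTime A (ξ ω) ↔ B < Z n ω) :
    ∫⁻ ω, (returnTime A (ξ ω) : ℝ≥0∞) ∂P = ∑' n, P {ω | B < Z n ω} := by
  have hm : ∀ n, MeasurableSet {ω | B < Z n ω} := fun n =>
    measurableSet_lt measurable_const (hZm n)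
  calc ∫⁻ ω, (returnTime A (ξ ω) : ℝ≥0∞) ∂P
      = ∫⁻ ω, ∑' n, {ω | B < Z n ω}.indicator (1 : Ω → ℝ≥0∞) ω ∂P := by
        refine lintegral_congr_ae ?_
        filter_upwards [h] with ω hω
        rw [toENNReal_eq_tsum]
        refine tsum_congr fun n => ?_
        by_cases hn : B < Z n ω
        · simp [indicator, hn, (hω n).2 hn]
        · have := mt (hω n).1 hn
          simp only [indicator, mem_ofPred_eq, hn, this, if_false]
    _ = _ := by
        rw [lintegral_tsum fun n => (measurable_one.indicator (hm n)).aemeasurable]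
        exact tsum_congr fun n => lintegral_indicator_one (hm n)

end ReturnTime

/-! ### Lyapunov functions -/

section LyapunovFunctions

variable {g : ℝ → ℝ} {γ U X η : ℝ} {F : ℝ → ℝ → ℝ} {μ : Measure ℝ} [IsProbabilityMeasure μ]

theorem IsLanding.exists_lintegral_rpow_add_le (hμ : IsReflectionLaw μ)
    (hU : ∀ᵐ a ∂μ, |Real.tan a| ≤ U) (hF : IsLanding g U X F) (h : Flat g U X η)
    (hg : RegularTube g γ) (hg0 : Tendsto g atTop (𝓝 0)) {p : ℝ}
    (hp : driftCoeff γ (∫ a, Real.tan a ^ 2 ∂μ) p < 0) :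
    ∃ c > 0, ∀ᶠ x in atTop, ∫⁻ a, ENNReal.ofReal (F x a ^ p) ∂μ
      + ENNReal.ofReal (c * (x ^ p * (g x / x) ^ 2)) ≤ ENNReal.ofReal (x ^ p) := by
  set d := driftCoeff γ (∫ a, Real.tan a ^ 2 ∂μ) p with hd
  refine ⟨-d / 2, by linarith, ?_⟩
  filter_upwards [hF.eventually_abs_drift_le hμ hU h hg hg0 p (show 0 < -d / 2 by linarith),
    eventually_gt_atTop (2 * X)] with x hx hxX
  obtain ⟨hi, hx⟩ := hx
  have hX := h.one_le
  have hF0 : 0 ≤ᵐ[μ] fun a => F x a ^ p := by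
    filter_upwards [hU] with a ha
    have := hF.lt X x a le_rfl hxX ha
    exact Real.rpow_nonneg (by linarith) p
  have hxp : 0 ≤ x ^ p * (g x / x) ^ 2 := by
    have := Real.rpow_nonneg (show 0 ≤ x by linarith) p
    positivity
  rw [← ofReal_integral_eq_lintegral_ofReal hi hF0,
    ← ENNReal.ofReal_add (integral_nonneg_of_ae hF0) (mul_nonneg (by linarith) hxp)]
  refine ENNReal.ofReal_le_ofReal ?_
  have := (abs_le.1 hx).2
  rw [← hd] at this
  linarith

theorem IsLanding.eventually_lintegral_rpow_add_one_le (hμ : IsReflectionLaw μ)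
    (hU : ∀ᵐ a ∂μ, |Real.tan a| ≤ U) (hF : IsLanding g U X F) (h : Flat g U X η)
    (hg : RegularTube g γ) (hg0 : Tendsto g atTop (𝓝 0)) {p : ℝ} (hpγ : 2 - 2 * γ < p)
    (hp : driftCoeff γ (∫ a, Real.tan a ^ 2 ∂μ) p < 0) :
    ∀ᶠ x in atTop, ∫⁻ a, ENNReal.ofReal (F x a ^ p) ∂μ + 1 ≤ ENNReal.ofReal (x ^ p) := by
  obtain ⟨c, hc, h1⟩ := hF.exists_lintegral_rpow_add_le hμ hU h hg hg0 hp
  filter_upwards [h1, ((hg.tendsto_rpow_mul_atTop hpγ).const_mul_atTop hc).eventually_ge_atTop 1]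
    with x hx hx1
  refine le_trans ?_ hx
  gcongr
  rw [← ENNReal.ofReal_one]
  exact ENNReal.ofReal_le_ofReal hx1

theorem RegularTube.exists_le_rpow_mul (hg : RegularTube g γ) {B : ℝ} (hB : 1 ≤ B) {c : ℝ}
    (hc : 0 < c) (p K : ℝ) : ∃ m : ℝ≥0∞, m ≠ 0 ∧ m ≠ ∞ ∧ ∀ z, B < z → z ≤ K →
      m ≤ ENNReal.ofReal (c * (z ^ p * (g z / z) ^ 2)) := by
  rcases lt_or_ge K B with hK | hK
  · exact ⟨1, one_ne_zero, ENNReal.one_ne_top, fun z h1 h2 => by linarith⟩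
  have hcont : ContinuousOn (fun z => c * (z ^ p * (g z / z) ^ 2)) (Icc B K) := by
    have hz : ∀ z ∈ Icc B K, z ≠ 0 := fun z hz => by linarith [hz.1]
    have h1 : ContinuousOn g (Icc B K) := hg.continuousOn.mono fun z hz => hB.trans hz.1
    have h2 : ContinuousOn (fun z : ℝ => z ^ p) (Icc B K) :=
      continuousOn_id.rpow_const fun z hz' => Or.inl (hz z hz')
    exact continuousOn_const.mul (h2.mul ((h1.div continuousOn_id hz).pow 2))
  obtain ⟨z₀, hz₀, hmin⟩ := isCompact_Icc.exists_isMinOn (nonempty_Icc.2 hK) hcont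
  have hz0 : 0 < z₀ := by linarith [hz₀.1]
  have hgz : 0 < g z₀ := hg.pos z₀ (hB.trans hz₀.1)
  refine ⟨ENNReal.ofReal (c * (z₀ ^ p * (g z₀ / z₀) ^ 2)), ?_, ENNReal.ofReal_ne_top,
    fun z h1 h2 => ENNReal.ofReal_le_ofReal (hmin ⟨h1.le, h2⟩)⟩
  rw [ne_eq, ENNReal.ofReal_eq_zero, not_le]
  have := Real.rpow_pos_of_pos hz0 p
  positivity

/-- The truncated function `z ↦ M (z ^ p - B ^ p) - z ^ q`. -/
noncomputable def truncated (B p q M z : ℝ) : ℝ≥0∞ :=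
  (Ioi B).indicator (fun z => ENNReal.ofReal (M * (z ^ p - B ^ p) - z ^ q)) z

theorem measurable_truncated (B p q M : ℝ) : Measurable (truncated B p q M) := by
  refine Measurable.indicator ?_ measurableSet_Ioi
  fun_prop

/-- For `0 < z ≤ B` the expression is nonpositive, so `ENNReal.ofReal` already performs the
truncation at `B`. -/
theorem truncated_of_pos {B p q M z : ℝ} (hp : 0 ≤ p) (hM : 0 ≤ M) (hz : 0 < z) :
    truncated B p q M z = ENNReal.ofReal (M * (z ^ p - B ^ p) - z ^ q) := by
  by_cases h : B < z
  · exact indicator_of_mem (mem_Ioi.2 h) _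
  · rw [truncated, indicator_of_notMem (by simpa using h), eq_comm, ENNReal.ofReal_eq_zero]
    have h1 := Real.rpow_le_rpow hz.le (not_lt.1 h) hp
    have h2 := Real.rpow_nonneg hz.le q
    nlinarith

/-- As `q > p`, the expression can be positive only where `z ^ (q - p) < M`, which bounds `z`. -/
theorem truncated_le {B p q M : ℝ} (hB : 0 < B) (hp : 0 ≤ p) (hpq : p < q) (hM : 0 ≤ M) (z : ℝ) :
    truncated B p q M z ≤ ENNReal.ofReal (M * (M ^ (q - p)⁻¹) ^ p) := by
  refine indicator_le (fun z hz => ENNReal.ofReal_le_ofReal ?_) z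
  have hz0 : 0 < z := hB.trans hz
  have hBp := Real.rpow_nonneg hB.le p
  have hzp := Real.rpow_nonneg hz0.le p
  have hzq : z ^ q = z ^ p * z ^ (q - p) := by rw [← Real.rpow_add hz0]; congr 1; ring
  have hR : 0 ≤ M * (M ^ (q - p)⁻¹) ^ p := by positivity
  rcases le_or_gt M (z ^ (q - p)) with h | h
  · have : M * z ^ p ≤ z ^ q := by rw [hzq, mul_comm]; gcongr
    nlinarith [mul_nonneg hM hBp]
  · have h1 : z ≤ M ^ (q - p)⁻¹ := by
      have := Real.rpow_le_rpow (Real.rpow_nonneg hz0.le _) h.le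
        (inv_nonneg.2 (sub_pos.2 hpq).le)
      rwa [← Real.rpow_mul hz0.le, mul_inv_cancel₀ (sub_pos.2 hpq).ne', Real.rpow_one] at this
    have h2 : M * z ^ p ≤ M * (M ^ (q - p)⁻¹) ^ p := by gcongr
    have h3 := Real.rpow_nonneg hz0.le q
    nlinarith [mul_nonneg hM hBp]

theorem IsLanding.eventually_truncated_le (hμ : IsReflectionLaw μ)
    (hU : ∀ᵐ a ∂μ, |Real.tan a| ≤ U) (hF : IsLanding g U X F) (h : Flat g U X η)
    (hg : RegularTube g γ) (hg0 : Tendsto g atTop (𝓝 0)) {p q : ℝ} (hp0 : 0 ≤ p)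
    (hp : 0 < driftCoeff γ (∫ a, Real.tan a ^ 2 ∂μ) p) (hqγ : q < 2 - 2 * γ) :
    ∀ᶠ z in atTop, ∀ B M : ℝ, 0 ≤ M →
      truncated B p q M z ≤ ∫⁻ a, truncated B p q M (F z a) ∂μ + 1 := by
  set dp := driftCoeff γ (∫ a, Real.tan a ^ 2 ∂μ) p with hdp
  set dq := driftCoeff γ (∫ a, Real.tan a ^ 2 ∂μ) q with hdq
  have hlim : Tendsto (fun z => (dq + 1) * (z ^ q * (g z / z) ^ 2)) atTop (𝓝 0) := by
    simpa using (hg.tendsto_rpow_mul_zero hqγ).const_mul (dq + 1)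
  -- For `p` the tolerance is the coefficient itself, leaving nonnegative drift. Hence `M` only
  -- multiplies a favourable term, and the threshold on `z` does not depend on it.
  filter_upwards [hF.eventually_abs_drift_le hμ hU h hg hg0 p hp,
    hF.eventually_abs_drift_le hμ hU h hg hg0 q one_pos, hlim.eventually_le_const one_pos,
    eventually_gt_atTop (2 * X)] with z hzp hzq hz1 hzX B M hM
  obtain ⟨hip, hzp⟩ := hzp
  obtain ⟨hiq, hzq⟩ := hzq
  rw [← hdp] at hzp
  rw [← hdq] at hzq
  have hX := h.one_le
  have hFz : ∀ᵐ a ∂μ, truncated B p q M (F z a)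
      = ENNReal.ofReal (M * (F z a ^ p - B ^ p) - F z a ^ q) := by
    filter_upwards [hU] with a ha
    have := hF.lt X z a le_rfl hzX ha
    exact truncated_of_pos hp0 hM (by linarith)
  have hi1 : Integrable (fun a => F z a ^ p - B ^ p) μ := hip.sub (integrable_const _)
  have hi2 : Integrable (fun a => M * (F z a ^ p - B ^ p)) μ := hi1.const_mul M
  have hi : Integrable (fun a => M * (F z a ^ p - B ^ p) - F z a ^ q) μ := hi2.sub hiq
  have hint : ∫ a, (M * (F z a ^ p - B ^ p) - F z a ^ q) ∂μ
      = M * (∫ a, F z a ^ p ∂μ - B ^ p) - ∫ a, F z a ^ q ∂μ := by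
    rw [integral_sub hi2 hiq, integral_const_mul,
      integral_sub hip (integrable_const _)]
    simp
  have h1 : z ^ p ≤ ∫ a, F z a ^ p ∂μ := by linarith [(abs_le.1 hzp).1]
  have h2 : ∫ a, F z a ^ q ∂μ ≤ z ^ q + 1 := by linarith [(abs_le.1 hzq).2]
  rw [truncated_of_pos hp0 hM (by linarith), lintegral_congr_ae hFz]
  have h3 : M * (z ^ p - B ^ p) - z ^ q
      ≤ ∫ a, max (M * (F z a ^ p - B ^ p) - F z a ^ q) 0 ∂μ + 1 := by
    have h4 : ∫ a, (M * (F z a ^ p - B ^ p) - F z a ^ q) ∂μ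
        ≤ ∫ a, max (M * (F z a ^ p - B ^ p) - F z a ^ q) 0 ∂μ :=
      integral_mono hi hi.pos_part fun a => le_max_left _ _
    nlinarith
  calc ENNReal.ofReal (M * (z ^ p - B ^ p) - z ^ q)
      ≤ ENNReal.ofReal (∫ a, max (M * (F z a ^ p - B ^ p) - F z a ^ q) 0 ∂μ + 1) :=
        ENNReal.ofReal_le_ofReal h3
    _ ≤ ENNReal.ofReal (∫ a, max (M * (F z a ^ p - B ^ p) - F z a ^ q) 0 ∂μ) + ENNReal.ofReal 1 :=
        ENNReal.ofReal_add_le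
    _ = _ := by
        rw [ofReal_integral_eq_lintegral_ofReal hi.pos_part
          (Eventually.of_forall fun a => le_max_right _ _), ENNReal.ofReal_one]
        simp [ENNReal.ofReal_max]

theorem eq_top_of_forall_truncated_le {B p q x₀ : ℝ} (hB : 0 < B) (hp : 0 < p) (hx₀ : B < x₀)
    {T : ℝ≥0∞} (hT : ∀ M, 0 ≤ M → truncated B p q M x₀ ≤ T) : T = ∞ := by
  by_contra hne
  have h1 : 0 < x₀ ^ p - B ^ p := sub_pos.2 (Real.rpow_lt_rpow hB.le hx₀ hp)
  have h2 := Real.rpow_nonneg (hB.trans hx₀).le q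
  have h3 : 0 ≤ T.toReal := ENNReal.toReal_nonneg
  -- With this `M` the value at `x₀` is `T + 1`.
  have hM : 0 ≤ (x₀ ^ q + T.toReal + 1) / (x₀ ^ p - B ^ p) := by positivity
  have h4 := hT _ hM
  rw [truncated_of_pos hp.le hM (hB.trans hx₀), div_mul_cancel₀ _ h1.ne',
    ENNReal.ofReal_le_iff_le_toReal hne] at h4
  linarith

end LyapunovFunctions

/-! ### Choice of exponents and classification -/

section Classification

variable {g : ℝ → ℝ} {γ U X η : ℝ} {F : ℝ → ℝ → ℝ} {μ : Measure ℝ} [IsProbabilityMeasure μ]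

theorem exists_exponent_of_lt {γ v : ℝ} (hv : 0 ≤ v) (h : γ < -v) :
    ∃ q, 2 - 2 * γ < q ∧ driftCoeff γ v q < 0 := by
  -- At `2 - 2γ + t` the bracket in `driftCoeff` is `γ + v + t v`, and this `t` gives `t v ≤ -(γ +
  -- v) / 2`.
  set t := -(γ + v) / (2 * (v + 1)) with ht
  have ht0 : 0 < t := by
    have : 0 < -(γ + v) := by linarith
    positivity
  refine ⟨2 - 2 * γ + t, by linarith, ?_⟩
  have h1 : t * (2 * (v + 1)) = -(γ + v) := div_mul_cancel₀ _ (by positivity)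
  have h2 : γ * (1 + 2 * v) + (2 - 2 * γ + t - 1) * v < 0 := by nlinarith
  exact mul_neg_of_pos_of_neg (by linarith) h2

theorem exists_exponents_of_gt {γ v : ℝ} (hγ : γ ≤ 0) (h : -v < γ) :
    ∃ p q, 0 < p ∧ p < q ∧ q < 2 - 2 * γ ∧ 0 < driftCoeff γ v p := by
  have hv : 0 < v := by linarith
  -- At `2 - 2γ - (2/3) s` the bracket in `driftCoeff` is `(γ + v) / 3`.
  set s := (γ + v) / v with hs
  have hs0 : 0 < s := div_pos (by linarith) hv
  have hs1 : s ≤ 1 := (div_le_one hv).2 (by linarith)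
  have hsv : s * v = γ + v := div_mul_cancel₀ _ hv.ne'
  refine ⟨2 - 2 * γ - 2 / 3 * s, 2 - 2 * γ - 1 / 3 * s, by linarith, by linarith, by linarith, ?_⟩
  have h2 : 0 < γ * (1 + 2 * v) + (2 - 2 * γ - 2 / 3 * s - 1) * v := by nlinarith
  exact mul_pos (by linarith) h2

theorem IsLanding.eventually_tsum_ne_top (hμ : IsReflectionLaw μ)
    (hU : ∀ᵐ a ∂μ, |Real.tan a| ≤ U) (hF : IsLanding g U X F) (h : Flat g U X η)
    (hg : RegularTube g γ) (hg0 : Tendsto g atTop (𝓝 0))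
    (hv : γ < -∫ a, Real.tan a ^ 2 ∂μ) :
    ∀ᶠ B in atTop, ∀ (x₀ : ℝ) (Ω : Type*) [MeasurableSpace Ω] (P : Measure Ω)
      [IsProbabilityMeasure P] (α : ℕ → Ω → ℝ), (∀ n, Measurable (α n)) →
      (∀ n, P.map (α n) = μ) → iIndepFun α P →
      ∑' n, P {ω | B < stoppedChain F B x₀ (fun k => α k ω) n} ≠ ∞ := by
  obtain ⟨q, hq, hd⟩ := exists_exponent_of_lt (integral_nonneg fun a => sq_nonneg _) hv
  filter_upwards [eventually_forall_ge_atTop.2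
    (hF.eventually_lintegral_rpow_add_one_le hμ hU h hg hg0 hq hd)]
    with B hB x₀ Ω _ P _ α hα hlaw hind
  refine ne_top_of_le_ne_top ENNReal.ofReal_ne_top (tsum_measure_le hF.measurable hα hlaw hind
    (φ := fun x => ENNReal.ofReal (x ^ q)) (by fun_prop) fun z hz => hB z hz.le)

theorem IsLanding.eventually_tendsto_zero_and_tsum_eq_top (hμ : IsReflectionLaw μ)
    (hU : ∀ᵐ a ∂μ, |Real.tan a| ≤ U) (hF : IsLanding g U X F) (h : Flat g U X η)
    (hg : RegularTube g γ) (hg0 : Tendsto g atTop (𝓝 0)) (hγ : γ ≤ 0)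
    (hv : -∫ a, Real.tan a ^ 2 ∂μ < γ) :
    ∀ᶠ B in atTop, ∀ x₀ : ℝ, B < x₀ → ∀ (Ω : Type*) [MeasurableSpace Ω] (P : Measure Ω)
      [IsProbabilityMeasure P] (α : ℕ → Ω → ℝ), (∀ n, Measurable (α n)) →
      (∀ n, P.map (α n) = μ) → iIndepFun α P →
      Tendsto (fun n => P {ω | B < stoppedChain F B x₀ (fun k => α k ω) n}) atTop (𝓝 0) ∧
      ∑' n, P {ω | B < stoppedChain F B x₀ (fun k => α k ω) n} = ∞ := by
  obtain ⟨p, q, hp0, hpq, hq, hd⟩ := exists_exponents_of_gt hγ hv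
  -- The coefficient is `γ (1 + 2v) - v / 2`, negative because `-v < γ ≤ 0` forces `v > 0`.
  have hd2 : driftCoeff γ (∫ a, Real.tan a ^ 2 ∂μ) (1 / 2) < 0 := by
    rw [driftCoeff]
    nlinarith
  obtain ⟨c, hc, hrec⟩ := hF.exists_lintegral_rpow_add_le hμ hU h hg hg0 hd2
  filter_upwards [eventually_forall_ge_atTop.2 hrec, eventually_forall_ge_atTop.2
    (hF.eventually_truncated_le hμ hU h hg hg0 hp0.le hd hq),
    eventually_ge_atTop 1] with B hB1 hB2 hB x₀ hx₀ Ω _ P _ α hα hlaw hind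
  have hB0 : 0 < B := by linarith
  have hmax : ∀ z, B < z → max z 1 = z := fun z hz => max_eq_left (by linarith)
  have hlim : Tendsto (fun n => P {ω | B < stoppedChain F B x₀ (fun k => α k ω) n})
      atTop (𝓝 0) := by
    have hgm : Measurable fun x => g (max x 1) := (continuous_comp_max hg.continuousOn).measurable
    have hem : Measurable fun x : ℝ => c * (x ^ (1 / 2 : ℝ) * (g (max x 1) / x) ^ 2) :=
      measurable_const.mul ((measurable_id.pow_const _).mul ((hgm.div measurable_id).pow_const 2))
    refine tendsto_measure_zero hF.measurable hα hlaw hind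
      (φ := fun x => ENNReal.ofReal (x ^ (1 / 2 : ℝ)))
      (e := fun x => ENNReal.ofReal (c * (x ^ (1 / 2 : ℝ) * (g (max x 1) / x) ^ 2)))
      (by fun_prop) hem.ennreal_ofReal (fun z hz => ?_) ENNReal.ofReal_ne_top (fun M hM => ?_)
      fun K => ?_
    · simp only [hmax z hz]
      exact hB1 z hz.le
    · obtain ⟨K, hK⟩ := eventually_atTop.1
        ((tendsto_rpow_atTop (show (0 : ℝ) < 1 / 2 by norm_num)).eventually_ge_atTop M.toReal)
      refine ⟨K, fun z hz => ?_⟩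
      rw [← ENNReal.ofReal_toReal hM]
      exact ENNReal.ofReal_le_ofReal (hK z hz.le)
    · obtain ⟨m, hm0, hmt, hm⟩ := hg.exists_le_rpow_mul hB hc (1 / 2) K
      refine ⟨m, hm0, hmt, fun z hz hzK => ?_⟩
      rw [hmax z hz]
      exact hm z hz hzK
  refine ⟨hlim, eq_top_of_forall_truncated_le hB0 hp0 hx₀ (q := q) fun M hM => ?_⟩
  exact le_tsum_measure hF.measurable hα hlaw hind (measurable_truncated B p q M)
    (fun z hz => hB2 z hz.le B M hM) (fun z hz => indicator_of_notMem (by simpa using hz) _)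
    ENNReal.ofReal_ne_top (truncated_le hB0 hp0.le hpq hM) hlim

end Classification

end StochasticBilliard

theorem mainTheorem4 (g : ℝ → ℝ) (γ : ℝ) (μ : Measure ℝ) [IsProbabilityMeasure μ]
    (hμ : StochasticBilliard.IsReflectionLaw μ)
    (hγ : γ ≤ 0)
    (hg : StochasticBilliard.RegularTube g γ)
    (hg0 : Tendsto g atTop (𝓝 0)) :
    ∃ A₀ : ℝ, 0 < A₀ ∧ ∀ A : ℝ, 1 ≤ A → A₀ < A →
      ∀ p₀ ∈ frontier (StochasticBilliard.tube g A), 2 * A < p₀.1 →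
      ∀ (Ω : Type*) [MeasurableSpace Ω] (P : Measure Ω) [IsProbabilityMeasure P]
        (α : ℕ → Ω → ℝ), (∀ n, HasLaw (α n) μ P) → iIndepFun α P →
        (γ < -∫ a, Real.tan a ^ 2 ∂μ →
          StochasticBilliard.PositiveRecurrent P A
            (fun ω => StochasticBilliard.collisions g A p₀ (fun n => α n ω))) ∧
        (-∫ a, Real.tan a ^ 2 ∂μ < γ →
          StochasticBilliard.NullRecurrent P A
            (fun ω => StochasticBilliard.collisions g A p₀ (fun n => α n ω))) := by
  open StochasticBilliard in
  obtain ⟨U, hU0, hU⟩ := hμ.exists_bound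
  obtain ⟨X, hX⟩ := hg.exists_flat hg0 hU0
  obtain ⟨F, hF⟩ := hX.exists_isLanding hg
  have hU' : ∀ᵐ a ∂μ, |Real.tan a| ≤ U := hU.mono fun _ ha => ha.1
  have hX1 := hX.one_le
  have setup : ∀ A : ℝ, X ≤ A → ∀ p₀ ∈ frontier (tube g A), 2 * A < p₀.1 →
      ∀ (Ω : Type _) [MeasurableSpace Ω] (P : Measure Ω) [IsProbabilityMeasure P]
        (α : ℕ → Ω → ℝ), (∀ n, HasLaw (α n) μ P) → iIndepFun α P →
        ∃ β : ℕ → Ω → ℝ, (∀ n, Measurable (β n)) ∧ (∀ n, P.map (β n) = μ) ∧ iIndepFun β P ∧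
          ∀ᵐ ω ∂P, ∀ n : ℕ, (n : ℕ∞) < returnTime A (collisions g A p₀ fun k => α k ω) ↔
            2 * A < stoppedChain F (2 * A) p₀.1 (fun k => β k ω) n := by
    intro A hA p₀ hp₀ hp₀A Ω _ P _ α hlaw hind
    have hβ : ∀ n, α n =ᵐ[P] (hlaw n).aemeasurable.mk (α n) := fun n =>
      (hlaw n).aemeasurable.ae_eq_mk
    refine ⟨fun n => (hlaw n).aemeasurable.mk (α n), fun n => (hlaw n).aemeasurable.measurable_mk,
      fun n => ?_, hind.congr hβ, hF.ae_lt_returnTime_iff hA ?_ hU hlaw hβ⟩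
    · rw [← Measure.map_congr (hβ n), (hlaw n).map_eq]
    · exact (hg.mem_frontier_tube_iff (hX1.trans hA) (by linarith)).1 hp₀
  rcases lt_trichotomy γ (-∫ a, Real.tan a ^ 2 ∂μ) with hv | hv | hv
  · obtain ⟨Y, hY⟩ := eventually_atTop.1 (hF.eventually_tsum_ne_top hμ hU' hX hg hg0 hv)
    refine ⟨max X Y, lt_max_of_lt_left (by linarith), fun A hA1 hA p₀ hp₀ hp₀A Ω _ P _ α hlaw hind =>
      ⟨fun _ => ?_, fun hv' => absurd hv hv'.not_gt⟩⟩
    have hXA := (le_max_left X Y).trans hA.le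
    have hYA := (le_max_right X Y).trans hA.le
    obtain ⟨β, hβm, hβlaw, hβ, hae⟩ := setup A hXA p₀ hp₀ hp₀A Ω P α hlaw hind
    have hsum := hY (2 * A) (by linarith) p₀.1 Ω P β hβm hβlaw hβ
    refine ⟨recurrent_of_tendsto hae (ENNReal.tendsto_atTop_zero_of_tsum_ne_top hsum), ?_⟩
    rw [lintegral_returnTime (fun n => measurable_stoppedChain hF.measurable hβm n) hae]
    exact hsum.lt_top
  -- In the critical case both implications are vacuous.
  · exact ⟨1, one_pos, fun A _ _ p₀ _ _ Ω _ P _ α _ _ =>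
      ⟨fun h => absurd hv h.ne, fun h => absurd hv h.ne'⟩⟩
  · obtain ⟨Y, hY⟩ := eventually_atTop.1
      (hF.eventually_tendsto_zero_and_tsum_eq_top hμ hU' hX hg hg0 hγ hv)
    refine ⟨max X Y, lt_max_of_lt_left (by linarith), fun A hA1 hA p₀ hp₀ hp₀A Ω _ P _ α hlaw hind =>
      ⟨fun hv' => absurd hv hv'.not_gt, fun _ => ?_⟩⟩
    have hXA := (le_max_left X Y).trans hA.le
    have hYA := (le_max_right X Y).trans hA.le
    obtain ⟨β, hβm, hβlaw, hβ, hae⟩ := setup A hXA p₀ hp₀ hp₀A Ω P α hlaw hind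
    obtain ⟨hlim, hsum⟩ := hY (2 * A) (by linarith) p₀.1 hp₀A Ω P β hβm hβlaw hβ
    refine ⟨recurrent_of_tendsto hae hlim, ?_⟩
    rw [lintegral_returnTime (fun n => measurable_stoppedChain hF.measurable hβm n) hae]
    exact hsum
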